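/- Let $n \ge 1$, $t_0 \in \mathbb R$, and consider the system $$\dot x = f(t,x), \qquad t \ge t_0, \quad x \in \mathbb R^n.$$ Assume that $f$ is piecewise continuous in $t$ (off a set of times common to all $x$ and with finitely many points in each bounded interval, $f(\cdot,x)$ is continuous, and one-sided limits in $t$ exist everywhere), that $f(t,\cdot)$ is continuously differentiable for every $t \ge t_0$, with Jacobian matrix $\frac{\partial f}{\partial x}$ bounded on compact subsets of $[t_0,\infty)\times\mathbb R^n$, and that for every $x \in \mathbb R^n$ the (absolutely continuous) solution $\xi(t,t_0,x)$ with $\xi(t_0,t_0,x)=x$ exists for all $t \ge t_0$. Let $K \subset \mathbb R^n$ be compact with nonempty interior, and write $\xi(t,t_0,K) = \{\xi(t,t_0,x) : x \in K\}$. Fix a norm $|\cdot|$ on $\mathbb R^n$. For $T \ge 0$ and $\varepsilon>0$ let $S(f,t_0,\varepsilon,T,K)$ be the minimal cardinality of a set $E \subset K$ such that for every $\bar x \in K$ there is $x \in E$ with $|\xi(t,t_0,\bar x)-\xi(t,t_0,x)| < \varepsilon$ for all $t \in [t_0,t_0+T]$. The topological entropy is $$h(f,t_0,K) := \lim_{\varepsilon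 \searrow 0}\ \limsup_{T\to\infty} \frac1T \log S(f,t_0,\varepsilon,T,K) \in [0,\infty].$$ For any norm on $\mathbb R^n$ (possibly different from $|\cdot|$), with induced matrix norm $\|\cdot\|$, let $\mu(A) := \lim_{s\searrow 0} \frac{\|I+sA\|-1}{s}$ be the matrix measure of $A \in \mathbb R^{n\times n}$. Then $$\max\{\check\chi,0\} \;\le\; h(f,t_0,K) \;\le\; n \max\{\hat\mu,0\},$$ where, as extended real numbers, $$\hat\mu := \limsup_{t\to\infty}\ \max_{v\in \mathrm{co}(\xi(t,t_0,K))} \mu\Big(\frac{\partial f}{\partial x}(t,v)\Big), \qquad \check\chi := \liminf_{t\to\infty}\ \min_{v\in \xi(t,t_0,K)} \mathrm{tr}\Big(\frac{\partial f}{\partial x}(t,v)\Big),$$ and $\mathrm{co}$ denotes the convex hull. -/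

import Mathlib

open Set Filter Topology MeasureTheory

/-- `f` is piecewise continuous in time on `[t₀, ∞)`: there is a set `D` of exceptional times, common
to all states and with finitely many points in each bounded interval, off which `f(·, x)` is
continuous, and all one-sided limits in time exist (in `ℝⁿ`). -/
def PiecewiseContinuousInTime {n : ℕ} (f : ℝ → (Fin n → ℝ) → (Fin n → ℝ)) (t₀ : ℝ) : Prop :=
  ∃ D : Set ℝ, (∀ T : ℝ, (D ∩ Icc t₀ T).Finite) ∧
    (∀ x : Fin n → ℝ, ∀ t ∈ Ici t₀ \ D, ContinuousWithinAt (fun s => f s x) (Ici t₀) t) ∧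
    (∀ x : Fin n → ℝ, ∀ t ∈ Ici t₀, ∃ l, Tendsto (fun s => f s x) (𝓝[>] t) (𝓝 l)) ∧
    (∀ x : Fin n → ℝ, ∀ t ∈ Ioi t₀, ∃ l, Tendsto (fun s => f s x) (𝓝[<] t) (𝓝 l))

/-- The Jacobian matrix `∂f/∂x (t, v)`. -/
noncomputable def jacobian {n : ℕ} (f : ℝ → (Fin n → ℝ) → (Fin n → ℝ)) (t : ℝ)
    (v : Fin n → ℝ) : Matrix (Fin n) (Fin n) ℝ :=
  LinearMap.toMatrix' (fderiv ℝ (f t) v : (Fin n → ℝ) →ₗ[ℝ] (Fin n → ℝ))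

/-- The entries of `∂f/∂x` are bounded on compact subsets of `[t₀, ∞) × ℝⁿ`. -/
def JacobianLocallyBounded {n : ℕ} (f : ℝ → (Fin n → ℝ) → (Fin n → ℝ)) (t₀ : ℝ) : Prop :=
  ∀ T R : ℝ, ∃ C : ℝ, ∀ t ∈ Icc t₀ T, ∀ v : Fin n → ℝ, ‖v‖ ≤ R →
    ∀ i j : Fin n, |jacobian f t v i j| ≤ C

/-- `φ` is a solution on `[t₀, ∞)` of `ẋ = f(t, x)`, `x(t₀) = x₀`, in the integral form, that is,
`φ` is locally absolutely continuous and satisfies the equation almost everywhere. -/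
def IsSolution {n : ℕ} (f : ℝ → (Fin n → ℝ) → (Fin n → ℝ)) (t₀ : ℝ) (x₀ : Fin n → ℝ)
    (φ : ℝ → (Fin n → ℝ)) : Prop :=
  ∀ t, t₀ ≤ t → IntervalIntegrable (fun s => f s (φ s)) volume t₀ t ∧
    φ t = x₀ + ∫ s in t₀..t, f s (φ s)

/-- Every initial state at time `t₀` has a solution that exists on all of `[t₀, ∞)`. -/
def ForwardComplete {n : ℕ} (f : ℝ → (Fin n → ℝ) → (Fin n → ℝ)) (t₀ : ℝ) : Prop :=
  ∀ x₀ : Fin n → ℝ, ∃ φ : ℝ → (Fin n → ℝ), IsSolution f t₀ x₀ φ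

/-- `ξ(t, t₀, x)`: the value at time `t` of the solution with state `x` at time `t₀`. -/
noncomputable def flow {n : ℕ} (f : ℝ → (Fin n → ℝ) → (Fin n → ℝ)) (t₀ t : ℝ)
    (x : Fin n → ℝ) : Fin n → ℝ :=
  Classical.epsilon (fun φ : ℝ → (Fin n → ℝ) => IsSolution f t₀ x φ) t

/-- The reachable set `ξ(t, t₀, K)`. -/
noncomputable def reachableSet {n : ℕ} (f : ℝ → (Fin n → ℝ) → (Fin n → ℝ)) (t₀ t : ℝ)
    (K : Set (Fin n → ℝ)) : Set (Fin n → ℝ) :=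
  flow f t₀ t '' K

/-- `E ⊆ K` is `(T, ε)`-spanning, the distance between states being measured by the norm `N`. -/
def IsSpanning {n : ℕ} (N : Seminorm ℝ (Fin n → ℝ)) (f : ℝ → (Fin n → ℝ) → (Fin n → ℝ)) (t₀ : ℝ)
    (K : Set (Fin n → ℝ)) (T ε : ℝ) (E : Set (Fin n → ℝ)) : Prop :=
  E ⊆ K ∧ ∀ y ∈ K, ∃ x ∈ E, ∀ t ∈ Icc t₀ (t₀ + T), N (flow f t₀ t y - flow f t₀ t x) < ε

/-- `S(f, t₀, ε, T, K)`: the minimal cardinality of a `(T, ε)`-spanning set. -/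
noncomputable def spanningNumber {n : ℕ} (N : Seminorm ℝ (Fin n → ℝ))
    (f : ℝ → (Fin n → ℝ) → (Fin n → ℝ)) (t₀ : ℝ) (K : Set (Fin n → ℝ)) (T ε : ℝ) : ℕ∞ :=
  ⨅ E ∈ {E : Set (Fin n → ℝ) | IsSpanning N f t₀ K T ε E}, E.encard

/-- The topological entropy `h(f, t₀, K) = lim_{ε ↘ 0} limsup_{T → ∞} (1/T) log S(f, t₀, ε, T, K)`,
an extended real number; the limit exists because `S` is antitone in `ε`. -/
noncomputable def topEntropy {n : ℕ} (N : Seminorm ℝ (Fin n → ℝ))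
    (f : ℝ → (Fin n → ℝ) → (Fin n → ℝ)) (t₀ : ℝ) (K : Set (Fin n → ℝ)) : EReal :=
  limUnder (𝓝[>] (0 : ℝ)) (fun ε : ℝ =>
    limsup (fun T : ℝ =>
      ((1 / T : ℝ) : EReal) * ENNReal.log (spanningNumber N f t₀ K T ε : ENNReal)) atTop)

/-- The norm on matrices that is induced by the norm `N` on `ℝⁿ`. -/
noncomputable def inducedNorm {n : ℕ} (N : Seminorm ℝ (Fin n → ℝ))
    (A : Matrix (Fin n) (Fin n) ℝ) : ℝ :=
  sSup ((fun v : Fin n → ℝ => N (A.mulVec v)) '' {v | N v ≤ 1})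

/-- The matrix measure (logarithmic norm) `μ(A) = lim_{s ↘ 0} (‖I + s A‖ - 1) / s`. -/
noncomputable def matrixMeasure {n : ℕ} (N : Seminorm ℝ (Fin n → ℝ))
    (A : Matrix (Fin n) (Fin n) ℝ) : ℝ :=
  limUnder (𝓝[>] (0 : ℝ)) (fun s : ℝ => (inducedNorm N (1 + s • A) - 1) / s)

/-- `μ̂ = limsup_{t → ∞} max { μ(∂f/∂x (t, v)) | v ∈ co ξ(t, t₀, K) }`. -/
noncomputable def muHat {n : ℕ} (N : Seminorm ℝ (Fin n → ℝ))
    (f : ℝ → (Fin n → ℝ) → (Fin n → ℝ)) (t₀ : ℝ) (K : Set (Fin n → ℝ)) : EReal :=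
  limsup (fun t : ℝ => ⨆ v ∈ convexHull ℝ (reachableSet f t₀ t K),
    (matrixMeasure N (jacobian f t v) : EReal)) atTop

/-- `χ̌ = liminf_{t → ∞} min { tr (∂f/∂x (t, v)) | v ∈ ξ(t, t₀, K) }`. -/
noncomputable def chiCheck {n : ℕ} (f : ℝ → (Fin n → ℝ) → (Fin n → ℝ)) (t₀ : ℝ)
    (K : Set (Fin n → ℝ)) : EReal :=
  liminf (fun t : ℝ => ⨅ v ∈ reachableSet f t₀ t K,
    ((jacobian f t v).trace : EReal)) atTop

/-! Upper bound: let `z` be the difference of two solutions starting in `K`. Where `M z` is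
differentiable, its derivative is `l z'` for a functional `l` supporting `M` at `z`. The scalar mean
value theorem for `l ∘ f(t, ·)` gives `l z' = l (J z)`, with `J` the Jacobian at a point of the
segment between the two states, hence of the convex hull of the reachable set; and `l (J z) ≤ μ(J) M
z`. Grönwall then shows that distances grow at most like `exp (c T)` for any `c ≥ 0` above `μ̂`, so
a grid of mesh proportional to `ε exp (-c T)` spans, with `O(exp (n c T))` points
(`seminorm_flow_sub_le`, `exists_net_card_le`).

Lower bound: by Liouville's formula the volume of the reachable set grows at least like `exp (c T)`
for any `c` below `χ̌`. A spanning set covers it by `N`-balls of radius `ε`, all of one fixed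
volume, so their number grows at least at that rate (`ofReal_exp_mul_volume_le`,
`volume_reachableSet_le`). Smoothness of the flow in the initial state is not taken for granted:
Grönwall makes the flow Lipschitz, Rademacher makes it differentiable almost everywhere, and the
variational equation is derived in integrated form by dominated convergence. Nonnegativity of the
entropy only needs `K` to be nonempty. -/

/-! ### Grönwall inequalities and seminorms on `ℝⁿ`. -/

/-- Grönwall's inequality for absolutely continuous functions. -/
theorem AbsolutelyContinuousOnInterval.le_exp_mul {u : ℝ → ℝ} {a b k : ℝ} (hab : a ≤ b)
    (hu : AbsolutelyContinuousOnInterval u a b)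
    (h : ∀ᵐ t, t ∈ Icc a b → deriv u t ≤ k * u t) :
    u b ≤ Real.exp (k * (b - a)) * u a := by
  have he : ContDiff ℝ 1 (fun t : ℝ => Real.exp (-k * t)) := by fun_prop
  have hv := (he.contDiffOn (s := uIcc a b)).absolutelyContinuousOnInterval.fun_mul hu
  have hi := hv.integral_deriv_eq_sub
  have hle : ∫ t in a..b, deriv (fun t => Real.exp (-k * t) * u t) t ≤ 0 := by
    rw [intervalIntegral.integral_of_le hab]
    refine integral_nonpos_of_ae ?_
    rw [EventuallyLE, ae_restrict_iff' measurableSet_Ioc]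
    filter_upwards [h, hu.ae_differentiableAt] with t ht hd hmem
    have hm : t ∈ Icc a b := Ioc_subset_Icc_self hmem
    have hd' := hd (by rwa [uIcc_of_le hab])
    have h1 : HasDerivAt (fun t : ℝ => Real.exp (-k * t)) (Real.exp (-k * t) * (-k)) t := by
      simpa using ((hasDerivAt_id t).const_mul (-k)).exp
    rw [(h1.fun_mul hd'.hasDerivAt).deriv]
    have := ht hm
    have hp := Real.exp_pos (-k * t)
    simp only [Pi.zero_apply]
    nlinarith
  have h2 : Real.exp (-k * b) * u b ≤ Real.exp (-k * a) * u a := by linarith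
  have h3 : Real.exp (k * (b - a)) = Real.exp (k * b) * Real.exp (-k * a) := by
    rw [← Real.exp_add]; ring_nf
  calc u b = Real.exp (k * b) * (Real.exp (-k * b) * u b) := by
        rw [← mul_assoc, ← Real.exp_add]; simp
    _ ≤ Real.exp (k * b) * (Real.exp (-k * a) * u a) :=
        mul_le_mul_of_nonneg_left h2 (Real.exp_pos _).le
    _ = _ := by rw [h3]; ring

theorem AbsolutelyContinuousOnInterval.exp_mul_le {u : ℝ → ℝ} {a b k : ℝ} (hab : a ≤ b)
    (hu : AbsolutelyContinuousOnInterval u a b)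
    (h : ∀ᵐ t, t ∈ Icc a b → k * u t ≤ deriv u t) :
    Real.exp (k * (b - a)) * u a ≤ u b := by
  have := hu.fun_neg.le_exp_mul (k := k) hab (by
    filter_upwards [h] with t ht hm
    have : deriv (fun x => - u x) t = - deriv u t := deriv.fun_neg
    rw [this]
    linarith [ht hm])
  linarith

/-- Hahn–Banach: extend `c • x ↦ c * p x` from the line through `x`. -/
theorem Seminorm.exists_supporting_functional {E : Type*} [AddCommGroup E] [Module ℝ E]
    (p : Seminorm ℝ E) (x : E) :
    ∃ l : E →ₗ[ℝ] ℝ, l x = p x ∧ ∀ y, |l y| ≤ p y := by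
  by_cases hx : x = 0
  · exact ⟨0, by simp [hx], fun y => by simp⟩
  · let e := LinearEquiv.toSpanNonzeroSingleton ℝ E x hx
    obtain ⟨g, hg, hb⟩ := Module.Dual.exists_extension_of_le_seminorm_real
      (Submodule.span ℝ {x}) (p x • (e.symm : _ →ₗ[ℝ] ℝ)) (p := p) (by
        intro y
        obtain ⟨c, rfl⟩ := e.surjective y
        have : ((e c : Submodule.span ℝ {x}) : E) = c • x := rfl
        rw [this, map_smul_eq_mul]
        simp only [LinearMap.smul_apply, LinearEquiv.coe_coe, LinearEquiv.symm_apply_apply,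
          smul_eq_mul, Real.norm_eq_abs]
        rw [mul_comm]
        exact mul_le_mul_of_nonneg_right (le_abs_self c) (apply_nonneg p x))
    refine ⟨g, ?_, hb⟩
    have h1 : ((e 1 : Submodule.span ℝ {x}) : E) = x := one_smul ℝ x
    have := hg (e 1)
    rw [h1] at this
    simpa using this

/-- `p ∘ z - l ∘ z` is nonnegative and vanishes at `t`, so its derivative there is zero. Any
supporting functional serves, and `p` itself need not be differentiable at `z t`. -/
theorem Seminorm.deriv_comp_eq_supporting_functional {n : ℕ} {p : Seminorm ℝ (Fin n → ℝ)}
    {z : ℝ → Fin n → ℝ} {w : Fin n → ℝ} {t : ℝ} (hz : HasDerivAt z w t)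
    (hp : DifferentiableAt ℝ (fun s => p (z s)) t) {l : (Fin n → ℝ) →ₗ[ℝ] ℝ}
    (hl : l (z t) = p (z t)) (hle : ∀ y, |l y| ≤ p y) :
    deriv (fun s => p (z s)) t = l w := by
  have h1 : HasDerivAt (fun s => l (z s)) (l w) t :=
    (LinearMap.toContinuousLinearMap l).hasFDerivAt.comp_hasDerivAt t hz
  have hmin : IsLocalMin (fun s => p (z s) - l (z s)) t := by
    refine Eventually.of_forall fun s => ?_
    have := (le_abs_self _).trans (hle (z s))
    simp only [hl, sub_self]
    linarith
  have := hmin.hasDerivAt_eq_zero (hp.hasDerivAt.sub h1)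
  linarith

theorem Seminorm.exists_le_norm {n : ℕ} (p : Seminorm ℝ (Fin n → ℝ)) :
    ∃ C : ℝ, 0 < C ∧ ∀ x, p x ≤ C * ‖x‖ := by
  refine ⟨(∑ i, p (Pi.single i 1)) + 1, ?_, fun x => ?_⟩
  · have : 0 ≤ ∑ i, p (Pi.single i (1 : ℝ)) := Finset.sum_nonneg fun i _ => apply_nonneg p _
    linarith
  · have hx : x = ∑ i, x i • (Pi.single i (1 : ℝ) : Fin n → ℝ) := by
      ext j
      simp [Finset.sum_apply, Pi.single_apply]
    have h1 : p x ≤ ∑ i, ‖x‖ * p (Pi.single i (1 : ℝ)) := by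
      conv_lhs => rw [hx]
      refine (Finset.le_sum_of_subadditive p (map_zero p).le (map_add_le_add p) _ _).trans
        (Finset.sum_le_sum fun i _ => ?_)
      rw [map_smul_eq_mul]
      exact mul_le_mul_of_nonneg_right (norm_le_pi_norm x i) (apply_nonneg p _)
    rw [← Finset.mul_sum] at h1
    nlinarith [norm_nonneg x]

theorem Seminorm.abs_sub_le_of_le_norm {n : ℕ} {p : Seminorm ℝ (Fin n → ℝ)} {C : ℝ}
    (hC : ∀ x, p x ≤ C * ‖x‖) (x y : Fin n → ℝ) : |p x - p y| ≤ C * ‖x - y‖ := by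
  rw [abs_sub_le_iff]
  constructor
  · exact (le_trans (by linarith [map_sub_le_add p x y, map_add_le_add p (x - y) y,
      (by simp : p (x - y + y) = p x)]) (hC (x - y)))
  · rw [norm_sub_rev]
    exact (le_trans (by linarith [map_add_le_add p (y - x) x,
      (by simp : p (y - x + x) = p y)]) (hC (y - x)))

theorem Seminorm.exists_norm_le {n : ℕ} (p : Seminorm ℝ (Fin n → ℝ))
    (hp : ∀ x, p x = 0 → x = 0) : ∃ c : ℝ, 0 < c ∧ ∀ x, c * ‖x‖ ≤ p x := by
  obtain ⟨C, hC0, hC⟩ := p.exists_le_norm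
  have hcont : Continuous p := by
    refine (LipschitzWith.of_dist_le_mul (K := C.toNNReal) fun x y => ?_).continuous
    rw [Real.dist_eq, dist_eq_norm, Real.coe_toNNReal C hC0.le]
    exact p.abs_sub_le_of_le_norm hC x y
  by_cases hne : (Metric.sphere (0 : Fin n → ℝ) 1).Nonempty
  · obtain ⟨x₀, hx₀, hmin⟩ := (isCompact_sphere (0 : Fin n → ℝ) 1).exists_isMinOn hne
      hcont.continuousOn
    have hx₀' : ‖x₀‖ = 1 := by simpa using hx₀
    refine ⟨p x₀, lt_of_le_of_ne (apply_nonneg p _) fun h => ?_, fun x => ?_⟩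
    · rw [hp x₀ h.symm] at hx₀'
      simp at hx₀'
    · by_cases hx : x = 0
      · simp [hx]
      · have hxn : 0 < ‖x‖ := norm_pos_iff.2 hx
        have := hmin (show ‖x‖⁻¹ • x ∈ Metric.sphere (0 : Fin n → ℝ) 1 by
          simp [norm_smul, hxn.ne'])
        simp only [mem_ofPred_eq, map_smul_eq_mul, norm_inv, norm_norm] at this
        rw [inv_mul_eq_div, le_div_iff₀ hxn] at this
        exact this
  · refine ⟨1, one_pos, fun x => ?_⟩
    have hx : x = 0 := by
      by_contra hx
      exact hne ⟨‖x‖⁻¹ • x, by simp [norm_smul, hx]⟩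
    simp [hx]

/-! ### Induced norm and matrix measure. -/

section MatrixMeasure

variable {n : ℕ} {M : Seminorm ℝ (Fin n → ℝ)}

/-- Without this bound the real supremum in `inducedNorm` would take its default value `0`. -/
theorem bddAbove_inducedNorm (hM : ∀ x, M x = 0 → x = 0) (A : Matrix (Fin n) (Fin n) ℝ) :
    BddAbove ((fun v : Fin n → ℝ => M (A.mulVec v)) '' {v | M v ≤ 1}) := by
  obtain ⟨c, hc0, hc⟩ := M.exists_norm_le hM
  obtain ⟨C, hC0, hC⟩ := (M.comp A.mulVecLin).exists_le_norm
  refine ⟨C * (1 / c), ?_⟩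
  rintro _ ⟨v, hv, rfl⟩
  refine (hC v).trans (mul_le_mul_of_nonneg_left ?_ hC0.le)
  rw [le_div_iff₀ hc0, mul_comm]
  exact (hc v).trans hv

theorem le_inducedNorm_mul (hM : ∀ x, M x = 0 → x = 0) (A : Matrix (Fin n) (Fin n) ℝ)
    (v : Fin n → ℝ) : M (A.mulVec v) ≤ inducedNorm M A * M v := by
  by_cases hv : M v = 0
  · simp [hM v hv]
  · have hpos : 0 < M v := lt_of_le_of_ne (apply_nonneg M v) (Ne.symm hv)
    have := le_csSup (bddAbove_inducedNorm hM A) ⟨(M v)⁻¹ • v, by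
      simp [map_smul_eq_mul, abs_of_pos hpos, hpos.ne'], rfl⟩
    simp only [Matrix.mulVec_smul, map_smul_eq_mul, norm_inv, Real.norm_eq_abs,
      abs_of_pos hpos] at this
    rw [inv_mul_eq_div, div_le_iff₀ hpos] at this
    exact this

theorem inducedNorm_le {A : Matrix (Fin n) (Fin n) ℝ} {r : ℝ}
    (h : ∀ v, M v ≤ 1 → M (A.mulVec v) ≤ r) : inducedNorm M A ≤ r := by
  refine csSup_le ⟨_, 0, by simp, rfl⟩ ?_
  rintro _ ⟨v, hv, rfl⟩
  exact h v hv

theorem inducedNorm_nonneg (A : Matrix (Fin n) (Fin n) ℝ) : 0 ≤ inducedNorm M A :=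
  Real.sSup_nonneg (by rintro _ ⟨v, _, rfl⟩; exact apply_nonneg M _)

/-- The limit that defines the matrix measure exists. -/
theorem tendsto_matrixMeasure [Nonempty (Fin n)] (hM : ∀ x, M x = 0 → x = 0)
    (A : Matrix (Fin n) (Fin n) ℝ) :
    Tendsto (fun s : ℝ => (inducedNorm M (1 + s • A) - 1) / s) (𝓝[>] 0)
      (𝓝 (matrixMeasure M A)) := by
  -- For `s ≤ t`, `1 + s • A` is the convex combination of `1` and `1 + t • A` with weights `1 - s /
  -- t` and `s / t`, so convexity of the norm makes the quotient monotone in `s`.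
  have hmono : MonotoneOn (fun s : ℝ => (inducedNorm M (1 + s • A) - 1) / s) (Ioi 0) := by
    intro s hs t ht hst
    simp only [mem_Ioi] at hs ht
    simp only
    rw [div_le_div_iff₀ hs ht]
    have key : inducedNorm M (1 + s • A) ≤ (1 - s / t) + s / t * inducedNorm M (1 + t • A) := by
      refine inducedNorm_le fun v hv => ?_
      have h1 : (1 + s • A).mulVec v = (1 - s / t) • v + (s / t) • (1 + t • A).mulVec v := by
        simp only [Matrix.add_mulVec, Matrix.one_mulVec, Matrix.smul_mulVec, smul_add, smul_smul]
        rw [div_mul_cancel₀ s ht.ne']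
        module
      have hq : s / t ≤ 1 := (div_le_one ht).2 hst
      have hq0 : 0 ≤ s / t := by positivity
      rw [h1]
      refine (map_add_le_add M _ _).trans ?_
      rw [map_smul_eq_mul, map_smul_eq_mul, Real.norm_of_nonneg hq0,
        Real.norm_of_nonneg (by linarith : 0 ≤ 1 - s / t)]
      have h2 := le_inducedNorm_mul hM (1 + t • A) v
      have h3 : inducedNorm M (1 + t • A) * M v ≤ inducedNorm M (1 + t • A) :=
        mul_le_of_le_one_right (inducedNorm_nonneg _) hv
      have h4 : (1 - s / t) * M v ≤ (1 - s / t) :=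
        mul_le_of_le_one_right (by linarith) hv
      have h5 := mul_le_mul_of_nonneg_left (h2.trans h3) hq0
      linarith
    have h6 := mul_le_mul_of_nonneg_right key ht.le
    have h7 : ((1 - s / t) + s / t * inducedNorm M (1 + t • A)) * t
        = t - s + s * inducedNorm M (1 + t • A) := by field_simp
    linarith
  -- The reverse triangle inequality on a basis vector bounds the quotient below. For `n = 0` the
  -- induced norm is `0` and the quotient `-1 / s` diverges, hence the `Nonempty` assumption.
  have hbdd : BddBelow ((fun s : ℝ => (inducedNorm M (1 + s • A) - 1) / s) '' Ioi 0) := by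
    obtain ⟨i⟩ := ‹Nonempty (Fin n)›
    have he : (Pi.single i (1 : ℝ) : Fin n → ℝ) ≠ 0 := by simp
    have hpos : 0 < M (Pi.single i (1 : ℝ)) :=
      lt_of_le_of_ne (apply_nonneg M _) fun h => he (hM _ h.symm)
    refine ⟨-(M (A.mulVec (Pi.single i 1)) / M (Pi.single i (1 : ℝ))), ?_⟩
    rintro _ ⟨s, hs, rfl⟩
    simp only [mem_Ioi] at hs
    simp only
    rw [le_div_iff₀ hs]
    have h1 := le_inducedNorm_mul hM (1 + s • A) (Pi.single i 1)
    have h2 : M (Pi.single i (1 : ℝ)) - s * M (A.mulVec (Pi.single i 1)) ≤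
        M ((1 + s • A).mulVec (Pi.single i 1)) := by
      have := map_sub_le_add M ((1 + s • A).mulVec (Pi.single i 1)) (s • A.mulVec (Pi.single i 1))
      rw [map_smul_eq_mul, Real.norm_of_nonneg hs.le] at this
      have h3 : (1 + s • A).mulVec (Pi.single i 1) - s • A.mulVec (Pi.single i 1)
          = Pi.single i 1 := by
        rw [Matrix.add_mulVec, Matrix.one_mulVec, Matrix.smul_mulVec]; simp
      rw [h3] at this
      linarith
    have h4 := h2.trans h1
    rw [← sub_nonneg]
    have : 0 ≤ (inducedNorm M (1 + s • A) - 1 + s * (M (A.mulVec (Pi.single i 1)) /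
        M (Pi.single i (1 : ℝ)))) * M (Pi.single i (1 : ℝ)) := by
      rw [add_mul, mul_assoc, div_mul_cancel₀ _ hpos.ne']
      linarith
    have := nonneg_of_mul_nonneg_left this hpos
    linarith
  exact tendsto_nhds_limUnder ⟨_, hmono.tendsto_nhdsGT hbdd⟩

/-- From `M z + s * l (A z) = l ((1 + s • A) z) ≤ ‖1 + s • A‖ * M z`, divide by `s` and let `s`
decrease to `0`. -/
theorem supporting_functional_le_matrixMeasure (hM : ∀ x, M x = 0 → x = 0)
    (A : Matrix (Fin n) (Fin n) ℝ) {z : Fin n → ℝ} {l : (Fin n → ℝ) →ₗ[ℝ] ℝ}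
    (hl : l z = M z) (hle : ∀ y, |l y| ≤ M y) :
    l (A.mulVec z) ≤ matrixMeasure M A * M z := by
  rcases isEmpty_or_nonempty (Fin n) with hn | hn
  · simp [Subsingleton.elim z 0, Subsingleton.elim (A.mulVec 0) 0]
  refine ge_of_tendsto ((tendsto_matrixMeasure hM A).mul_const (M z)) ?_
  filter_upwards [self_mem_nhdsWithin] with s hs
  simp only [mem_Ioi] at hs
  rw [div_mul_eq_mul_div, le_div_iff₀ hs]
  have h1 : l ((1 + s • A).mulVec z) = M z + s * l (A.mulVec z) := by
    rw [Matrix.add_mulVec, Matrix.one_mulVec, Matrix.smul_mulVec, map_add, map_smul, hl,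
      smul_eq_mul]
  have h2 := ((le_abs_self _).trans (hle ((1 + s • A).mulVec z))).trans
    (le_inducedNorm_mul hM (1 + s • A) z)
  rw [h1] at h2
  linarith

end MatrixMeasure

/-! ### Evolution of determinants under `Z' = A Z`. -/

section Det

variable {n : ℕ}

/-- Jacobi's formula: differentiate row by row. Row `i` of `A * Z` is a combination of the rows of
`Z`, and replacing row `i` of `Z` by it multiplies the determinant by `A i i`. -/
theorem HasDerivAt.det_of_eq_mul {Z : ℝ → Matrix (Fin n) (Fin n) ℝ}
    {A : Matrix (Fin n) (Fin n) ℝ} {t : ℝ}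
    (hZ : ∀ i j, HasDerivAt (fun s => Z s i j) ((A * Z t) i j) t) :
    HasDerivAt (fun s => (Z s).det) (A.trace * (Z t).det) t := by
  let D : ContinuousMultilinearMap ℝ (fun _ : Fin n => (Fin n → ℝ)) ℝ :=
    ⟨(Matrix.detRowAlternating (R := ℝ) (n := Fin n)).toMultilinearMap,
      (Continuous.matrix_det continuous_id : Continuous fun A : Matrix (Fin n) (Fin n) ℝ => A.det)⟩
  have hrow : HasDerivAt (fun s => (fun i => Z s i : Fin n → Fin n → ℝ))
      (fun i => (A * Z t) i) t :=
    hasDerivAt_pi.2 fun i => hasDerivAt_pi.2 fun j => hZ i j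
  have h := (D.hasFDerivAt (fun i => Z t i)).comp_hasDerivAt t hrow
  have hval : D.linearDeriv (fun i => Z t i) (fun i => (A * Z t) i) = A.trace * (Z t).det := by
    rw [ContinuousMultilinearMap.linearDeriv_apply, Matrix.trace, Finset.sum_mul]
    refine Finset.sum_congr rfl fun i _ => ?_
    have h1 : (A * Z t) i = ∑ k, A i k • Z t k := by
      ext j
      simp [Matrix.mul_apply, Finset.sum_apply]
    have h2 := Matrix.det_updateRow_sum (Z t) i (A i)
    rw [← h1] at h2
    exact h2
  rw [hval] at h
  exact h

theorem AbsolutelyContinuousOnInterval.const (c a b : ℝ) :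
    AbsolutelyContinuousOnInterval (fun _ : ℝ => c) a b :=
  (contDiff_const.contDiffOn (n := 1)).absolutelyContinuousOnInterval

theorem AbsolutelyContinuousOnInterval.fun_finset_sum {ι : Type*} (s : Finset ι) {F : ι → ℝ → ℝ}
    {a b : ℝ} (h : ∀ i ∈ s, AbsolutelyContinuousOnInterval (F i) a b) :
    AbsolutelyContinuousOnInterval (fun t => ∑ i ∈ s, F i t) a b := by
  classical
  induction s using Finset.induction_on with
  | empty => simpa using AbsolutelyContinuousOnInterval.const 0 a b
  | insert i s hi ih =>
    simp only [Finset.sum_insert hi]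
    exact (h i (by simp)).fun_add (ih fun j hj => h j (by simp [hj]))

theorem AbsolutelyContinuousOnInterval.fun_finset_prod {ι : Type*} (s : Finset ι) {F : ι → ℝ → ℝ}
    {a b : ℝ} (h : ∀ i ∈ s, AbsolutelyContinuousOnInterval (F i) a b) :
    AbsolutelyContinuousOnInterval (fun t => ∏ i ∈ s, F i t) a b := by
  classical
  induction s using Finset.induction_on with
  | empty => simpa using AbsolutelyContinuousOnInterval.const 1 a b
  | insert i s hi ih =>
    simp only [Finset.prod_insert hi]
    exact (h i (by simp)).fun_mul (ih fun j hj => h j (by simp [hj]))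

theorem AbsolutelyContinuousOnInterval.matrix_det {Z : ℝ → Matrix (Fin n) (Fin n) ℝ} {a b : ℝ}
    (hZ : ∀ i j, AbsolutelyContinuousOnInterval (fun s => Z s i j) a b) :
    AbsolutelyContinuousOnInterval (fun s => (Z s).det) a b := by
  simp only [Matrix.det_apply']
  exact .fun_finset_sum _ fun σ _ => .const_mul _ (.fun_finset_prod _ fun i _ => hZ _ _)

/-- A lower bound for the growth of the determinant along `Z' = A Z`. -/
theorem exp_mul_det_sq_le {Z A : ℝ → Matrix (Fin n) (Fin n) ℝ} {a b k : ℝ} (hab : a ≤ b)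
    (hZ : ∀ i j, AbsolutelyContinuousOnInterval (fun s => Z s i j) a b)
    (hd : ∀ᵐ t, t ∈ Icc a b → ∀ i j, HasDerivAt (fun s => Z s i j) ((A t * Z t) i j) t)
    (hA : ∀ t ∈ Icc a b, k ≤ (A t).trace) :
    Real.exp (2 * k * (b - a)) * (Z a).det ^ 2 ≤ (Z b).det ^ 2 := by
  have hac := (AbsolutelyContinuousOnInterval.matrix_det hZ)
  -- Squaring removes the sign of the determinant: `(det²)' = 2 (tr A) det² ≥ 2 k det²`.
  have := (hac.fun_mul hac).exp_mul_le (k := 2 * k) hab (by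
    filter_upwards [hd] with t ht hm
    have h1 := HasDerivAt.det_of_eq_mul (ht hm)
    rw [(h1.fun_mul h1).deriv]
    nlinarith [mul_le_mul_of_nonneg_right (hA t hm) (sq_nonneg (Z t).det)])
  simpa only [sq] using this

end Det

/-! ### Differences of solutions and local bounds for the flow. -/

section Solutions

variable {n : ℕ} {f : ℝ → (Fin n → ℝ) → (Fin n → ℝ)} {t₀ : ℝ}

theorem isSolution_flow (hf : ForwardComplete f t₀) (x : Fin n → ℝ) :
    IsSolution f t₀ x (fun t => flow f t₀ t x) :=
  Classical.epsilon_spec (hf x)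

theorem IsSolution.apply_initial {x : Fin n → ℝ} {φ : ℝ → Fin n → ℝ} (h : IsSolution f t₀ x φ) :
    φ t₀ = x := by
  simpa using (h t₀ le_rfl).2

theorem IsSolution.intervalIntegrable {x : Fin n → ℝ} {φ : ℝ → Fin n → ℝ}
    (h : IsSolution f t₀ x φ) {a b : ℝ} (ha : t₀ ≤ a) (hb : t₀ ≤ b) :
    IntervalIntegrable (fun s => f s (φ s)) volume a b :=
  (h a ha).1.symm.trans (h b hb).1

theorem IsSolution.sub_eq_integral {x : Fin n → ℝ} {φ : ℝ → Fin n → ℝ}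
    (h : IsSolution f t₀ x φ) {a b : ℝ} (ha : t₀ ≤ a) (hb : t₀ ≤ b) :
    φ b - φ a = ∫ s in a..b, f s (φ s) := by
  rw [(h a ha).2, (h b hb).2,
    ← intervalIntegral.integral_add_adjacent_intervals (h a ha).1 (h.intervalIntegrable ha hb)]
  abel

theorem IsSolution.continuousOn {x : Fin n → ℝ} {φ : ℝ → Fin n → ℝ}
    (h : IsSolution f t₀ x φ) (T : ℝ) : ContinuousOn φ (Icc t₀ T) := by
  rcases le_or_gt t₀ T with hT | hT
  · have h1 := intervalIntegral.continuousOn_primitive_interval' (h T hT).1 left_mem_uIcc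
    rw [uIcc_of_le hT] at h1
    exact (continuousOn_const.add h1).congr fun t ht => (h t ht.1).2
  · simp [Icc_eq_empty_of_lt hT]

theorem IsSolution.ae_hasDerivAt {x : Fin n → ℝ} {φ : ℝ → Fin n → ℝ}
    (h : IsSolution f t₀ x φ) (T : ℝ) :
    ∀ᵐ t, t ∈ Icc t₀ T → HasDerivAt φ (f t (φ t)) t := by
  rcases le_or_gt t₀ T with hT | hT
  · have hne : ∀ᵐ t : ℝ, t ≠ t₀ := by simp [ae_iff, measure_singleton]
    filter_upwards [(h T hT).1.ae_hasDerivAt_integral, hne] with t ht hne hm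
    have h1 := (ht (by rwa [uIcc_of_le hT]) t₀ left_mem_uIcc).const_add x
    refine h1.congr_of_eventuallyEq ?_
    filter_upwards [Ioi_mem_nhds (lt_of_le_of_ne hm.1 (Ne.symm hne))] with s hs
    exact (h s (le_of_lt hs)).2
  · simp [Icc_eq_empty_of_lt hT]

/-- `f(t, ·)` is Lipschitz with constant `L` on the closed ball of radius `R`, for `t ∈ [a, b]`. -/
def LipschitzOnBall (f : ℝ → (Fin n → ℝ) → (Fin n → ℝ)) (a b R L : ℝ) : Prop :=
  ∀ t ∈ Icc a b, ∀ x y : Fin n → ℝ, ‖x‖ ≤ R → ‖y‖ ≤ R → ‖f t x - f t y‖ ≤ L * ‖x - y‖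

theorem LipschitzOnBall.mono {a b a' b' R L : ℝ} (h : LipschitzOnBall f a b R L)
    (ha : a ≤ a') (hb : b' ≤ b) : LipschitzOnBall f a' b' R L :=
  fun t ht => h t ⟨ha.trans ht.1, ht.2.trans hb⟩

theorem fderiv_apply_eq_jacobian_mulVec (t : ℝ) (v w : Fin n → ℝ) :
    fderiv ℝ (f t) v w = (jacobian f t v).mulVec w := by
  rw [jacobian, LinearMap.toMatrix'_mulVec]
  rfl

theorem exists_lipschitzOnBall (hf_state : ∀ t, t₀ ≤ t → ContDiff ℝ 1 (f t))
    (hf_bdd : JacobianLocallyBounded f t₀) (T R : ℝ) :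
    ∃ L : ℝ, 0 ≤ L ∧ LipschitzOnBall f t₀ T R L := by
  obtain ⟨C, hC⟩ := hf_bdd T R
  refine ⟨n * |C|, by positivity, fun t ht x y hx hy => ?_⟩
  have hb : ∀ v ∈ Metric.closedBall (0 : Fin n → ℝ) R, ‖fderiv ℝ (f t) v‖ ≤ n * |C| := by
    intro v hv
    refine ContinuousLinearMap.opNorm_le_bound _ (by positivity) fun w => ?_
    rw [fderiv_apply_eq_jacobian_mulVec, pi_norm_le_iff_of_nonneg (by positivity)]
    intro i
    rw [Matrix.mulVec, dotProduct]
    refine (norm_sum_le _ _).trans ?_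
    have : ∀ j ∈ Finset.univ, ‖jacobian f t v i j * w j‖ ≤ |C| * ‖w‖ := by
      intro j _
      rw [norm_mul]
      exact mul_le_mul ((hC t ht v (by simpa using hv) i j).trans (le_abs_self C))
        (norm_le_pi_norm w j) (norm_nonneg _) (abs_nonneg _)
    refine (Finset.sum_le_sum this).trans ?_
    simp [mul_assoc]
  exact (convex_closedBall (0 : Fin n → ℝ) R).norm_image_sub_le_of_norm_fderiv_le (𝕜 := ℝ)
    (fun v _ => (hf_state t ht.1).differentiable (by simp) v) hb (by simpa using hy)
    (by simpa using hx)

variable {x y : Fin n → ℝ} {φ ψ : ℝ → Fin n → ℝ} {a b R L : ℝ}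

/-- The difference of two solutions is the integral of `f r (φ r) - f r (ψ r)`, which the Lipschitz
condition bounds by `L * δ`; this needs no bound on `f` itself. -/
theorem IsSolution.lipschitzOnWith_sub (hφ : IsSolution f t₀ x φ) (hψ : IsSolution f t₀ y ψ)
    (ha : t₀ ≤ a) (hab : a ≤ b) (hL0 : 0 ≤ L) (hL : LipschitzOnBall f a b R L)
    (hφR : ∀ t ∈ Icc a b, ‖φ t‖ ≤ R) (hψR : ∀ t ∈ Icc a b, ‖ψ t‖ ≤ R) {δ : ℝ}
    (hδ : ∀ t ∈ Icc a b, ‖φ t - ψ t‖ ≤ δ) :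
    LipschitzOnWith (L * δ).toNNReal (fun t => φ t - ψ t) (Icc a b) := by
  have hδ0 : 0 ≤ δ := (norm_nonneg _).trans (hδ a ⟨le_rfl, hab⟩)
  refine LipschitzOnWith.of_dist_le_mul fun s hs t ht => ?_
  rw [dist_eq_norm, Real.coe_toNNReal _ (mul_nonneg hL0 hδ0)]
  have hs0 := ha.trans hs.1
  have ht0 := ha.trans ht.1
  have h1 : φ s - ψ s - (φ t - ψ t) = ∫ r in t..s, (f r (φ r) - f r (ψ r)) := by
    rw [intervalIntegral.integral_sub (hφ.intervalIntegrable ht0 hs0)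
      (hψ.intervalIntegrable ht0 hs0), ← hφ.sub_eq_integral ht0 hs0, ← hψ.sub_eq_integral ht0 hs0]
    abel
  rw [h1, Real.dist_eq]
  refine intervalIntegral.norm_integral_le_of_norm_le_const fun r hr => ?_
  have hr' : r ∈ Icc a b := by
    have h2 := uIoc_subset_uIcc hr
    exact (uIcc_subset_Icc ht hs) h2
  exact (hL r hr' _ _ (hφR r hr') (hψR r hr')).trans
    (mul_le_mul_of_nonneg_left (hδ r hr') hL0)

/-- The seminorm of the difference of two solutions is absolutely continuous, and its derivative
is the value of a supporting functional at the difference of the vector fields. -/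
theorem IsSolution.seminorm_sub (hφ : IsSolution f t₀ x φ) (hψ : IsSolution f t₀ y ψ)
    (p : Seminorm ℝ (Fin n → ℝ)) (ha : t₀ ≤ a) (hab : a ≤ b) (hL0 : 0 ≤ L)
    (hL : LipschitzOnBall f a b R L)
    (hφR : ∀ t ∈ Icc a b, ‖φ t‖ ≤ R) (hψR : ∀ t ∈ Icc a b, ‖ψ t‖ ≤ R) :
    AbsolutelyContinuousOnInterval (fun t => p (φ t - ψ t)) a b ∧
    ∀ᵐ t, t ∈ Icc a b → ∃ l : (Fin n → ℝ) →ₗ[ℝ] ℝ, l (φ t - ψ t) = p (φ t - ψ t) ∧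
      (∀ v, |l v| ≤ p v) ∧
      deriv (fun t => p (φ t - ψ t)) t = l (f t (φ t) - f t (ψ t)) := by
  obtain ⟨C, hC0, hC⟩ := p.exists_le_norm
  have hp : LipschitzWith C.toNNReal p := LipschitzWith.of_dist_le_mul fun v w => by
    rw [Real.dist_eq, dist_eq_norm, Real.coe_toNNReal C hC0.le]
    exact p.abs_sub_le_of_le_norm hC v w
  have hz := hφ.lipschitzOnWith_sub hψ ha hab hL0 hL hφR hψR (δ := R + R) fun t ht =>
    (norm_sub_le _ _).trans (add_le_add (hφR t ht) (hψR t ht))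
  have hac : AbsolutelyContinuousOnInterval (fun t => p (φ t - ψ t)) a b := by
    have := hp.comp_lipschitzOnWith hz
    rw [← uIcc_of_le hab] at this
    exact this.absolutelyContinuousOnInterval
  refine ⟨hac, ?_⟩
  filter_upwards [hφ.ae_hasDerivAt b, hψ.ae_hasDerivAt b, hac.ae_differentiableAt]
    with t h1 h2 h3 hm
  have hm' : t ∈ Icc t₀ b := ⟨ha.trans hm.1, hm.2⟩
  obtain ⟨l, hl, hle⟩ := p.exists_supporting_functional (φ t - ψ t)
  exact ⟨l, hl, hle, Seminorm.deriv_comp_eq_supporting_functional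
    (z := fun t => φ t - ψ t) ((h1 hm').sub (h2 hm'))
    (h3 (by rwa [uIcc_of_le hab])) hl hle⟩

/-- Assuming the estimate for every supporting functional spares the caller from knowing which one
Hahn–Banach supplies. -/
theorem IsSolution.seminorm_sub_le (hφ : IsSolution f t₀ x φ) (hψ : IsSolution f t₀ y ψ)
    (p : Seminorm ℝ (Fin n → ℝ)) (ha : t₀ ≤ a) (hab : a ≤ b) (hL0 : 0 ≤ L)
    (hL : LipschitzOnBall f a b R L)
    (hφR : ∀ t ∈ Icc a b, ‖φ t‖ ≤ R) (hψR : ∀ t ∈ Icc a b, ‖ψ t‖ ≤ R) {k : ℝ}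
    (hk : ∀ t ∈ Icc a b, ∀ l : (Fin n → ℝ) →ₗ[ℝ] ℝ, l (φ t - ψ t) = p (φ t - ψ t) →
      (∀ v, |l v| ≤ p v) → l (f t (φ t) - f t (ψ t)) ≤ k * p (φ t - ψ t)) :
    p (φ b - ψ b) ≤ Real.exp (k * (b - a)) * p (φ a - ψ a) := by
  obtain ⟨hac, hd⟩ := hφ.seminorm_sub hψ p ha hab hL0 hL hφR hψR
  refine hac.le_exp_mul hab ?_
  filter_upwards [hd] with t ht hm
  obtain ⟨l, hl, hle, he⟩ := ht hm
  rw [he]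
  exact hk t hm l hl hle

theorem IsSolution.norm_sub_le (hφ : IsSolution f t₀ x φ) (hψ : IsSolution f t₀ y ψ)
    (ha : t₀ ≤ a) (hab : a ≤ b) (hL0 : 0 ≤ L) (hL : LipschitzOnBall f a b R L)
    (hφR : ∀ t ∈ Icc a b, ‖φ t‖ ≤ R) (hψR : ∀ t ∈ Icc a b, ‖ψ t‖ ≤ R) :
    ‖φ b - ψ b‖ ≤ Real.exp (L * (b - a)) * ‖φ a - ψ a‖ :=
  hφ.seminorm_sub_le hψ (normSeminorm ℝ (Fin n → ℝ)) ha hab hL0 hL hφR hψR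
    fun t ht _ _ hle => ((le_abs_self _).trans (hle _)).trans
      (hL t ht _ _ (hφR t ht) (hψR t ht))

theorem IsSolution.le_norm_sub (hφ : IsSolution f t₀ x φ) (hψ : IsSolution f t₀ y ψ)
    (ha : t₀ ≤ a) (hab : a ≤ b) (hL0 : 0 ≤ L) (hL : LipschitzOnBall f a b R L)
    (hφR : ∀ t ∈ Icc a b, ‖φ t‖ ≤ R) (hψR : ∀ t ∈ Icc a b, ‖ψ t‖ ≤ R) :
    Real.exp (-L * (b - a)) * ‖φ a - ψ a‖ ≤ ‖φ b - ψ b‖ := by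
  obtain ⟨hac, hd⟩ := hφ.seminorm_sub hψ (normSeminorm ℝ (Fin n → ℝ)) ha hab hL0 hL hφR hψR
  refine hac.exp_mul_le hab ?_
  filter_upwards [hd] with t ht hm
  obtain ⟨l, hl, hle, he⟩ := ht hm
  rw [he]
  have h1 := (neg_abs_le _).trans' (neg_le_neg (hle (f t (φ t) - f t (ψ t))))
  have h2 := hL t hm _ _ (hφR t hm) (hψR t hm)
  simp only [coe_normSeminorm] at h1 ⊢
  linarith

/-- Solutions that start near a given one stay near it on a compact interval of time. -/
theorem exists_nhds_flow_bound (hf_state : ∀ t, t₀ ≤ t → ContDiff ℝ 1 (f t))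
    (hf_bdd : JacobianLocallyBounded f t₀) (hf : ForwardComplete f t₀) (T : ℝ)
    (x : Fin n → ℝ) :
    ∃ R : ℝ, ∃ U ∈ 𝓝 x, ∀ y ∈ U, ∀ t ∈ Icc t₀ T, ‖flow f t₀ t y‖ ≤ R := by
  have hφ := isSolution_flow hf x
  obtain ⟨R₀, hR₀⟩ := isCompact_Icc.exists_bound_of_continuousOn (hφ.continuousOn T)
  obtain ⟨L, hL0, hL⟩ := exists_lipschitzOnBall hf_state hf_bdd T (R₀ + 1)
  -- Up to time `T`, Grönwall expands distances by at most `exp (L * (T - t₀))`, so from this ball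
  -- they stay below `1 / 2` as long as both orbits remain in the ball of radius `R₀ + 1`.
  refine ⟨R₀ + 1, Metric.ball x (Real.exp (-(L * (T - t₀))) / 2),
    Metric.ball_mem_nhds _ (by positivity), fun y hy => ?_⟩
  have hψ := isSolution_flow hf y
  suffices h : ∀ t ∈ Icc t₀ T, ‖flow f t₀ t y - flow f t₀ t x‖ < 1 by
    intro t ht
    have h1 := norm_add_le (flow f t₀ t y - flow f t₀ t x) (flow f t₀ t x)
    rw [sub_add_cancel] at h1
    linarith [h t ht, hR₀ t ht]
  by_contra! hcon
  obtain ⟨t₁, ht₁, hlt₁⟩ := hcon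
  have hcont : ContinuousOn (fun t => ‖flow f t₀ t y - flow f t₀ t x‖) (Icc t₀ T) :=
    ((hψ.continuousOn T).sub (hφ.continuousOn T)).norm
  have hclosed : IsCompact (Icc t₀ T ∩ (fun t => ‖flow f t₀ t y - flow f t₀ t x‖) ⁻¹' Ici 1) :=
    isCompact_Icc.of_isClosed_subset
      (hcont.preimage_isClosed_of_isClosed isClosed_Icc isClosed_Ici) inter_subset_left
  -- `τ` is the first time at which the distance reaches `1`. Up to and including `τ` the Lipschitz
  -- constant `L` is valid, so the distance at `τ` is below `1`, a contradiction.
  obtain ⟨τ, ⟨hτ, hτ1⟩, hmin⟩ := hclosed.exists_isLeast ⟨t₁, ht₁, hlt₁⟩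
  have hbefore : ∀ t ∈ Ico t₀ τ, ‖flow f t₀ t y - flow f t₀ t x‖ < 1 := by
    intro t ht
    by_contra! hge
    exact absurd (hmin ⟨⟨ht.1, ht.2.le.trans hτ.2⟩, hge⟩) (not_le.2 ht.2)
  have hdist : ‖y - x‖ < Real.exp (-(L * (T - t₀))) / 2 := by simpa [dist_eq_norm] using hy
  have hexp : Real.exp (-(L * (T - t₀))) ≤ 1 :=
    Real.exp_le_one_iff.2 (by nlinarith [hτ.1, hτ.2])
  have hne : t₀ ≠ τ := by
    rintro rfl
    simp only [mem_preimage, mem_Ici, hψ.apply_initial, hφ.apply_initial] at hτ1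
    linarith
  have hlt : t₀ < τ := lt_of_le_of_ne hτ.1 hne
  have hupto : ∀ t ∈ Icc t₀ τ, ‖flow f t₀ t y - flow f t₀ t x‖ ≤ 1 := by
    have hcl := (hcont.mono (Icc_subset_Icc_right hτ.2))
    intro t ht
    have hs := hcl.preimage_isClosed_of_isClosed isClosed_Icc (isClosed_Iic (a := (1 : ℝ)))
    have hsub : Ico t₀ τ ⊆ Icc t₀ τ ∩ (fun t => ‖flow f t₀ t y - flow f t₀ t x‖) ⁻¹' Iic 1 :=
      fun s hs => ⟨⟨hs.1, hs.2.le⟩, (hbefore s hs).le⟩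
    have := closure_minimal hsub hs
    rw [closure_Ico hne] at this
    exact (this ht).2
  have hg := hψ.norm_sub_le hφ le_rfl hτ.1 hL0 (hL.mono le_rfl hτ.2)
    (fun t ht => by
      have h1 := norm_add_le (flow f t₀ t y - flow f t₀ t x) (flow f t₀ t x)
      rw [sub_add_cancel] at h1
      linarith [hupto t ht, hR₀ t ⟨ht.1, ht.2.trans hτ.2⟩])
    (fun t ht => by linarith [hR₀ t ⟨ht.1, ht.2.trans hτ.2⟩])
  rw [hψ.apply_initial, hφ.apply_initial] at hg
  have h3 : Real.exp (L * (τ - t₀)) ≤ Real.exp (L * (T - t₀)) :=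
    Real.exp_le_exp.2 (mul_le_mul_of_nonneg_left (by linarith [hτ.2]) hL0)
  have h4 : Real.exp (L * (τ - t₀)) * ‖y - x‖ ≤
      Real.exp (L * (T - t₀)) * (Real.exp (-(L * (T - t₀))) / 2) :=
    mul_le_mul h3 hdist.le (norm_nonneg _) (Real.exp_pos _).le
  rw [← mul_div_assoc, ← Real.exp_add, add_neg_cancel, Real.exp_zero] at h4
  simp only [mem_preimage, mem_Ici] at hτ1
  linarith

theorem exists_flow_bound (hf_state : ∀ t, t₀ ≤ t → ContDiff ℝ 1 (f t))
    (hf_bdd : JacobianLocallyBounded f t₀) (hf : ForwardComplete f t₀)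
    {K : Set (Fin n → ℝ)} (hK : IsCompact K) (T : ℝ) :
    ∃ R : ℝ, ∀ x ∈ K, ∀ t ∈ Icc t₀ T, ‖flow f t₀ t x‖ ≤ R := by
  choose R U hU hR using exists_nhds_flow_bound hf_state hf_bdd hf T
  obtain ⟨s, -, hs⟩ := hK.elim_nhds_subcover U fun x _ => hU x
  refine ⟨∑ x ∈ s, |R x|, fun x hx t ht => ?_⟩
  obtain ⟨y, hy, hxy⟩ := mem_iUnion₂.1 (hs hx)
  exact ((hR y x hxy t ht).trans (le_abs_self _)).trans
    (Finset.single_le_sum (f := fun x => |R x|) (fun i _ => abs_nonneg _) hy)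

/-- On a compact time interval, the flow of a compact set stays in a ball on which the vector
field is Lipschitz. -/
theorem exists_flow_bound_lipschitz (hf_state : ∀ t, t₀ ≤ t → ContDiff ℝ 1 (f t))
    (hf_bdd : JacobianLocallyBounded f t₀) (hf : ForwardComplete f t₀)
    {K : Set (Fin n → ℝ)} (hK : IsCompact K) (T : ℝ) :
    ∃ R L : ℝ, 0 ≤ L ∧ LipschitzOnBall f t₀ T R L ∧
      ∀ x ∈ K, ∀ t ∈ Icc t₀ T, ‖flow f t₀ t x‖ ≤ R := by
  obtain ⟨R, hR⟩ := exists_flow_bound hf_state hf_bdd hf hK T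
  obtain ⟨L, hL0, hL⟩ := exists_lipschitzOnBall hf_state hf_bdd T R
  exact ⟨R, L, hL0, hL, hR⟩

end Solutions

/-! ### Upper bound: growth of distances and size of spanning sets. -/

section UpperBound

variable {n : ℕ} {f : ℝ → (Fin n → ℝ) → (Fin n → ℝ)} {t₀ : ℝ}

theorem exists_matrixMeasure_le_of_muHat_lt {M : Seminorm ℝ (Fin n → ℝ)} {K : Set (Fin n → ℝ)}
    {c : ℝ} (h : muHat M f t₀ K < c) :
    ∃ τ, t₀ ≤ τ ∧ ∀ t, τ ≤ t → ∀ v ∈ convexHull ℝ (reachableSet f t₀ t K),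
      matrixMeasure M (jacobian f t v) ≤ c := by
  obtain ⟨τ, hτ⟩ := eventually_atTop.1 (eventually_lt_of_limsup_lt h)
  refine ⟨max τ t₀, le_max_right _ _, fun t ht v hv => ?_⟩
  have h1 := (le_iSup₂ (f := fun (v : Fin n → ℝ)
    (_ : v ∈ convexHull ℝ (reachableSet f t₀ t K)) =>
      (matrixMeasure M (jacobian f t v) : EReal)) v hv).trans (hτ t ((le_max_left _ _).trans ht)).le
  exact_mod_cast h1

/-- Composing with `l` makes the vector field scalar, so the mean value theorem is exact at a single
point of the segment between the two states. That point may leave the reachable set, which is why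
the convex hull appears. -/
theorem seminorm_flow_sub_le {M : Seminorm ℝ (Fin n → ℝ)} (hM : ∀ x, M x = 0 → x = 0)
    (hf_state : ∀ t, t₀ ≤ t → ContDiff ℝ 1 (f t)) (hf_bdd : JacobianLocallyBounded f t₀)
    (hf : ForwardComplete f t₀) {K : Set (Fin n → ℝ)} (hK : IsCompact K) {c τ : ℝ}
    (hτ : t₀ ≤ τ) (h : ∀ t, τ ≤ t → ∀ v ∈ convexHull ℝ (reachableSet f t₀ t K),
      matrixMeasure M (jacobian f t v) ≤ c) {t : ℝ} (ht : τ ≤ t) {x y : Fin n → ℝ}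
    (hx : x ∈ K) (hy : y ∈ K) :
    M (flow f t₀ t x - flow f t₀ t y) ≤
      Real.exp (c * (t - τ)) * M (flow f t₀ τ x - flow f t₀ τ y) := by
  obtain ⟨R, L, hL0, hL, hR⟩ := exists_flow_bound_lipschitz hf_state hf_bdd hf hK t
  refine (isSolution_flow hf x).seminorm_sub_le (isSolution_flow hf y) M hτ ht hL0
    (hL.mono hτ le_rfl) (fun s hs => hR x hx s ⟨hτ.trans hs.1, hs.2⟩)
    (fun s hs => hR y hy s ⟨hτ.trans hs.1, hs.2⟩) fun s hs l hl hle => ?_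
  have hderiv : ∀ v ∈ (univ : Set (Fin n → ℝ)), HasFDerivWithinAt (fun v => l (f s v))
      ((LinearMap.toContinuousLinearMap l).comp (fderiv ℝ (f s) v)) univ v := fun v _ =>
    ((LinearMap.toContinuousLinearMap l).hasFDerivAt.comp v
      (((hf_state s (hτ.trans hs.1)).differentiable (by simp) v).hasFDerivAt)).hasFDerivWithinAt
  obtain ⟨v, hv, he⟩ := domain_mvt hderiv convex_univ (mem_univ (flow f t₀ s y))
    (mem_univ (flow f t₀ s x))
  have hvm : v ∈ convexHull ℝ (reachableSet f t₀ s K) :=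
    segment_subset_convexHull (mem_image_of_mem _ hy) (mem_image_of_mem _ hx) hv
  rw [map_sub, he]
  change l (fderiv ℝ (f s) v _) ≤ _
  rw [fderiv_apply_eq_jacobian_mulVec]
  exact (supporting_functional_le_matrixMeasure hM _ hl hle).trans
    (mul_le_mul_of_nonneg_right (h s hs.1 v hvm) (apply_nonneg M _))

theorem exists_seminorm_flow_sub_le_exp (N : Seminorm ℝ (Fin n → ℝ))
    {M : Seminorm ℝ (Fin n → ℝ)} (hM : ∀ x, M x = 0 → x = 0)
    (hf_state : ∀ t, t₀ ≤ t → ContDiff ℝ 1 (f t)) (hf_bdd : JacobianLocallyBounded f t₀)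
    (hf : ForwardComplete f t₀) {K : Set (Fin n → ℝ)} (hK : IsCompact K) {c : ℝ} (hc : 0 ≤ c)
    (h : muHat M f t₀ K < c) :
    ∃ B : ℝ, ∀ T x y, x ∈ K → y ∈ K → ∀ t ∈ Icc t₀ (t₀ + T),
      N (flow f t₀ t x - flow f t₀ t y) ≤ B * Real.exp (c * T) * ‖x - y‖ := by
  obtain ⟨τ, hτ0, hτ⟩ := exists_matrixMeasure_le_of_muHat_lt h
  obtain ⟨R, L, hL0, hL, hR⟩ := exists_flow_bound_lipschitz hf_state hf_bdd hf hK τ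
  obtain ⟨CN, hCN0, hCN⟩ := N.exists_le_norm
  obtain ⟨CM, hCM0, hCM⟩ := M.exists_le_norm
  obtain ⟨cM, hcM0, hcM⟩ := M.exists_norm_le hM
  set D := Real.exp (L * (τ - t₀)) with hD
  have hD0 : 0 < D := Real.exp_pos _
  have hstart : ∀ x ∈ K, ∀ y ∈ K, ∀ t ∈ Icc t₀ τ,
      ‖flow f t₀ t x - flow f t₀ t y‖ ≤ D * ‖x - y‖ := by
    intro x hx y hy t ht
    have h1 := (isSolution_flow hf x).norm_sub_le (isSolution_flow hf y) le_rfl ht.1 hL0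
      (hL.mono le_rfl ht.2) (fun s hs => hR x hx s ⟨hs.1, hs.2.trans ht.2⟩)
      (fun s hs => hR y hy s ⟨hs.1, hs.2.trans ht.2⟩)
    rw [(isSolution_flow hf x).apply_initial, (isSolution_flow hf y).apply_initial] at h1
    refine h1.trans (mul_le_mul_of_nonneg_right (Real.exp_le_exp.2 ?_) (norm_nonneg _))
    exact mul_le_mul_of_nonneg_left (by linarith [ht.2]) hL0
  -- `D` is the expansion up to `τ`. The summand `1` covers times before `τ`; `CM / cM` pays for
  -- passing from the sup norm to `M` and back at later times.
  refine ⟨CN * D * (1 + CM / cM), fun T x y hx hy t ht => ?_⟩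
  have hT : 0 ≤ T := by linarith [ht.1, ht.2]
  have he1 : 1 ≤ Real.exp (c * T) := Real.one_le_exp (mul_nonneg hc hT)
  have hq : 0 < CM / cM := by positivity
  have hxy := norm_nonneg (x - y)
  have hN := hCN (flow f t₀ t x - flow f t₀ t y)
  have key : ‖flow f t₀ t x - flow f t₀ t y‖ ≤
      D * (1 + CM / cM) * Real.exp (c * T) * ‖x - y‖ := by
    rcases le_total t τ with htτ | htτ
    · refine (hstart x hx y hy t ⟨ht.1, htτ⟩).trans (mul_le_mul_of_nonneg_right ?_ hxy)
      rw [mul_assoc]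
      refine le_mul_of_one_le_right hD0.le ?_
      nlinarith
    · have h1 := seminorm_flow_sub_le hM hf_state hf_bdd hf hK hτ0 hτ htτ hx hy
      have h2 := hstart x hx y hy τ ⟨hτ0, le_rfl⟩
      have h3 : Real.exp (c * (t - τ)) ≤ Real.exp (c * T) :=
        Real.exp_le_exp.2 (mul_le_mul_of_nonneg_left (by linarith [ht.2]) hc)
      have h4 : M (flow f t₀ t x - flow f t₀ t y) ≤
          Real.exp (c * T) * (CM * (D * ‖x - y‖)) :=
        h1.trans (mul_le_mul h3 ((hCM _).trans (mul_le_mul_of_nonneg_left h2 hCM0.le))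
          (apply_nonneg M _) (Real.exp_pos _).le)
      have h5 : ‖flow f t₀ t x - flow f t₀ t y‖ ≤
          Real.exp (c * T) * (CM * (D * ‖x - y‖)) / cM := by
        rw [le_div_iff₀ hcM0, mul_comm]
        exact (hcM _).trans h4
      refine h5.trans ?_
      have h6 : Real.exp (c * T) * (CM * (D * ‖x - y‖)) / cM
        = D * (CM / cM) * Real.exp (c * T) * ‖x - y‖ := by field_simp
      rw [h6]
      have : 0 ≤ D * Real.exp (c * T) * ‖x - y‖ := by positivity
      linarith
  calc _ ≤ _ := hN
    _ ≤ CN * (D * (1 + CM / cM) * Real.exp (c * T) * ‖x - y‖) :=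
      mul_le_mul_of_nonneg_left key hCN0.le
    _ = _ := by ring

/-- A bounded set in `ℝⁿ` has `δ`-nets of cardinality `O(δ⁻ⁿ)`. -/
theorem exists_net_card_le {K : Set (Fin n → ℝ)} {R : ℝ} (hR0 : 0 ≤ R) (hR : ∀ x ∈ K, ‖x‖ ≤ R)
    {δ : ℝ} (hδ0 : 0 < δ) (hδ1 : δ ≤ 1) :
    ∃ (E : Set (Fin n → ℝ)) (k : ℕ), E ⊆ K ∧ E.encard ≤ k ∧ (k : ℝ) ≤ ((2 * R + 2) / δ) ^ n ∧
      ∀ y ∈ K, ∃ x ∈ E, ‖y - x‖ < δ := by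
  -- `q` indexes the cubes of side `δ`. One point of `K` is chosen in each cube that meets `K`, so
  -- the net lies inside `K`; two points of a cube are less than `δ` apart in the sup norm.
  set q : (Fin n → ℝ) → (Fin n → ℤ) := fun x i => ⌊x i / δ⌋ with hq
  obtain ⟨E, hEK, hE⟩ := exists_subset_bijOn K q
  set P : Finset (Fin n → ℤ) := Fintype.piFinset fun _ : Fin n => Finset.Icc ⌊-R / δ⌋ ⌊R / δ⌋
    with hP
  refine ⟨E, P.card, hEK, ?_, ?_, fun y hy => ?_⟩
  · rw [← hE.injOn.encard_image, hE.image_eq, ← Set.encard_coe_eq_coe_finsetCard]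
    refine encard_le_encard ?_
    rintro _ ⟨x, hx, rfl⟩
    simp only [hP, Fintype.coe_piFinset, Set.mem_pi, Finset.coe_Icc, mem_Icc, hq]
    intro i _
    have h1 := abs_le.1 ((norm_le_pi_norm x i).trans (hR x hx))
    exact ⟨Int.floor_mono (div_le_div_of_nonneg_right h1.1 hδ0.le),
      Int.floor_mono (div_le_div_of_nonneg_right h1.2 hδ0.le)⟩
  · rw [hP, Fintype.card_piFinset]
    simp only [Int.card_Icc, Finset.prod_const, Finset.card_univ, Fintype.card_fin, Nat.cast_pow]
    refine pow_le_pow_left₀ (Nat.cast_nonneg _) ?_ n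
    have h1 : 0 ≤ ⌊R / δ⌋ + 1 - ⌊-R / δ⌋ := by
      have : ⌊-R / δ⌋ ≤ ⌊R / δ⌋ :=
        Int.floor_mono (div_le_div_of_nonneg_right (by linarith) hδ0.le)
      omega
    have h2 : (((⌊R / δ⌋ + 1 - ⌊-R / δ⌋).toNat : ℕ) : ℝ) =
        ((⌊R / δ⌋ + 1 - ⌊-R / δ⌋ : ℤ) : ℝ) := by
      exact_mod_cast congrArg (Int.cast (R := ℝ)) (Int.toNat_of_nonneg h1)
    rw [h2]
    push_cast
    have h3 := Int.floor_le (R / δ)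
    -- Each coordinate has at most `2 * R / δ + 2` indices; `δ ≤ 1` absorbs the `2` into `2 / δ`.
    have h4 := Int.lt_floor_add_one (-R / δ)
    have h5 : 2 ≤ 2 / δ := by rw [le_div_iff₀ hδ0]; linarith
    have h6 : (2 * R + 2) / δ = R / δ - (-R / δ) + 2 / δ := by ring
    linarith
  · obtain ⟨x, hx, hxy⟩ := hE.surjOn (mem_image_of_mem q hy)
    refine ⟨x, hx, (pi_norm_lt_iff hδ0).2 fun i => ?_⟩
    have h1 := Int.abs_sub_lt_one_of_floor_eq_floor (congrFun hxy i).symm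
    rw [← sub_div, abs_div, abs_of_pos hδ0, div_lt_one hδ0] at h1
    exact h1

theorem exists_spanningNumber_le_exp (N : Seminorm ℝ (Fin n → ℝ))
    {M : Seminorm ℝ (Fin n → ℝ)} (hM : ∀ x, M x = 0 → x = 0)
    (hf_state : ∀ t, t₀ ≤ t → ContDiff ℝ 1 (f t)) (hf_bdd : JacobianLocallyBounded f t₀)
    (hf : ForwardComplete f t₀) {K : Set (Fin n → ℝ)} (hK : IsCompact K) {c : ℝ} (hc : 0 ≤ c)
    (h : muHat M f t₀ K < c) {ε : ℝ} (hε : 0 < ε) :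
    ∃ C : ℝ, 0 < C ∧ ∀ T : ℝ, 0 ≤ T → ∃ k : ℕ, spanningNumber N f t₀ K T ε ≤ k ∧
      (k : ℝ) ≤ C * Real.exp (n * c * T) := by
  obtain ⟨B, hB⟩ := exists_seminorm_flow_sub_le_exp N hM hf_state hf_bdd hf hK hc h
  obtain ⟨R, hR⟩ := hK.isBounded.exists_norm_le
  -- Taking the maximum with `ε` makes the mesh `ε / (B' * exp (c * T))` positive and at most `1`.
  set B' := max B ε
  have hB'0 : 0 < B' := lt_of_lt_of_le hε (le_max_right _ _)
  set R' := max R 0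
  have hR'0 : 0 ≤ R' := le_max_right _ _
  refine ⟨((2 * R' + 2) * (B' / ε)) ^ n, by positivity, fun T hT => ?_⟩
  have he1 : 1 ≤ Real.exp (c * T) := Real.one_le_exp (mul_nonneg hc hT)
  have he0 := Real.exp_pos (c * T)
  obtain ⟨E, k, hEK, hk, hk', hnet⟩ := exists_net_card_le hR'0
    (fun x hx => (hR x hx).trans (le_max_left _ _)) (δ := ε / (B' * Real.exp (c * T)))
    (by positivity) (by
      rw [div_le_one (by positivity)]
      nlinarith [le_max_right B ε])
  have hspan : IsSpanning N f t₀ K T ε E := by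
    refine ⟨hEK, fun y hy => ?_⟩
    obtain ⟨x, hx, hxy⟩ := hnet y hy
    refine ⟨x, hx, fun t ht => ?_⟩
    rw [lt_div_iff₀ (by positivity)] at hxy
    refine ((hB T y x hy (hEK hx) t ht).trans ?_).trans_lt hxy
    rw [mul_comm]
    exact mul_le_mul_of_nonneg_left
      (mul_le_mul_of_nonneg_right (le_max_left _ _) he0.le) (norm_nonneg _)
  refine ⟨k, (iInf₂_le E hspan).trans hk, hk'.trans_eq ?_⟩
  rw [mul_assoc (n : ℝ), Real.exp_nat_mul, ← mul_pow]
  congr 1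
  field_simp

end UpperBound

/-! ### Lower bound: Liouville's formula and growth of volume. -/

section LowerBound

variable {n : ℕ} {f : ℝ → (Fin n → ℝ) → (Fin n → ℝ)} {t₀ : ℝ}

theorem exists_flow_lipschitz (hf_state : ∀ t, t₀ ≤ t → ContDiff ℝ 1 (f t))
    (hf_bdd : JacobianLocallyBounded f t₀) (hf : ForwardComplete f t₀)
    {K : Set (Fin n → ℝ)} (hK : IsCompact K) (T : ℝ) :
    ∃ R L C : ℝ, 0 ≤ L ∧ 0 ≤ C ∧ LipschitzOnBall f t₀ T R L ∧
      (∀ x ∈ K, ∀ t ∈ Icc t₀ T, ‖flow f t₀ t x‖ ≤ R) ∧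
      ∀ x ∈ K, ∀ y ∈ K, ∀ t ∈ Icc t₀ T, ‖flow f t₀ t x - flow f t₀ t y‖ ≤ C * ‖x - y‖ := by
  obtain ⟨R, L, hL0, hL, hR⟩ := exists_flow_bound_lipschitz hf_state hf_bdd hf hK T
  refine ⟨R, L, Real.exp (L * (T - t₀)), hL0, (Real.exp_pos _).le, hL, hR,
    fun x hx y hy t ht => ?_⟩
  have h1 := (isSolution_flow hf x).norm_sub_le (isSolution_flow hf y) le_rfl ht.1 hL0
    (hL.mono le_rfl ht.2) (fun s hs => hR x hx s ⟨hs.1, hs.2.trans ht.2⟩)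
    (fun s hs => hR y hy s ⟨hs.1, hs.2.trans ht.2⟩)
  rw [(isSolution_flow hf x).apply_initial, (isSolution_flow hf y).apply_initial] at h1
  refine h1.trans (mul_le_mul_of_nonneg_right (Real.exp_le_exp.2 ?_) (norm_nonneg _))
  exact mul_le_mul_of_nonneg_left (by linarith [ht.2]) hL0

/-- The lower Grönwall estimate prevents distinct orbits from merging. Injectivity is what the
change of variables for the volume requires. -/
theorem injOn_flow (hf_state : ∀ t, t₀ ≤ t → ContDiff ℝ 1 (f t))
    (hf_bdd : JacobianLocallyBounded f t₀) (hf : ForwardComplete f t₀)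
    {K : Set (Fin n → ℝ)} (hK : IsCompact K) {T : ℝ} (hT : t₀ ≤ T) :
    InjOn (flow f t₀ T) K := by
  obtain ⟨R, L, hL0, hL, hR⟩ := exists_flow_bound_lipschitz hf_state hf_bdd hf hK T
  intro x hx y hy hxy
  have h1 := (isSolution_flow hf x).le_norm_sub (isSolution_flow hf y) le_rfl hT hL0 hL
    (hR x hx) (hR y hy)
  rw [(isSolution_flow hf x).apply_initial, (isSolution_flow hf y).apply_initial, hxy, sub_self,
    norm_zero] at h1
  have h2 := nonpos_of_mul_nonpos_right h1 (Real.exp_pos _)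
  exact sub_eq_zero.1 (norm_le_zero_iff.1 h2)

theorem ae_differentiableAt_flow (hf_state : ∀ t, t₀ ≤ t → ContDiff ℝ 1 (f t))
    (hf_bdd : JacobianLocallyBounded f t₀) (hf : ForwardComplete f t₀)
    {K : Set (Fin n → ℝ)} (hK : IsCompact K) {T : ℝ} (hT : t₀ ≤ T) :
    ∀ᵐ x, x ∈ interior K → DifferentiableAt ℝ (flow f t₀ T) x := by
  obtain ⟨R, L, C, hL0, hC0, hL, hR, hC⟩ := exists_flow_lipschitz hf_state hf_bdd hf hK T
  have hlip : LipschitzOnWith C.toNNReal (flow f t₀ T) (interior K) :=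
    LipschitzOnWith.of_dist_le_mul fun x hx y hy => by
      rw [dist_eq_norm, dist_eq_norm, Real.coe_toNNReal C hC0]
      exact hC x (interior_subset hx) y (interior_subset hy) T ⟨hT, le_rfl⟩
  filter_upwards [hlip.ae_differentiableWithinAt_of_mem (μ := volume)] with x hx hm
  exact (hx hm).differentiableAt (isOpen_interior.mem_nhds hm)

/-- By Rademacher's theorem in space-time, almost every state is one at which the flow is
differentiable for almost every time. -/
theorem ae_ae_differentiableAt_flow (hf_state : ∀ t, t₀ ≤ t → ContDiff ℝ 1 (f t))
    (hf_bdd : JacobianLocallyBounded f t₀) (hf : ForwardComplete f t₀)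
    {K : Set (Fin n → ℝ)} (hK : IsCompact K) (T : ℝ) :
    ∀ᵐ x, x ∈ interior K → ∀ᵐ t, t ∈ Icc t₀ T → DifferentiableAt ℝ (flow f t₀ t) x := by
  rcases (interior K).eq_empty_or_nonempty with hemp | ⟨x₀, hx₀⟩
  · simp [hemp]
  obtain ⟨R, L, C, hL0, hC0, hL, hR, hC⟩ := exists_flow_lipschitz hf_state hf_bdd hf hK T
  have hx₀K := interior_subset hx₀
  have hR0 : t₀ ≤ T → 0 ≤ R := fun hT => (norm_nonneg _).trans (hR x₀ hx₀K t₀ ⟨le_rfl, hT⟩)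
  -- Subtracting a reference orbit leaves differentiability in the state unchanged and makes the map
  -- Lipschitz in time as well, as Rademacher's theorem on the product requires.
  set G : (Fin n → ℝ) × ℝ → (Fin n → ℝ) := fun z => flow f t₀ z.2 z.1 - flow f t₀ z.2 x₀ with hG
  have hlip : LipschitzOnWith (C + L * (R + R)).toNNReal G (interior K ×ˢ Icc t₀ T) := by
    refine LipschitzOnWith.of_dist_le_mul fun z hz w hw => ?_
    obtain ⟨x, s⟩ := z
    obtain ⟨y, t⟩ := w
    obtain ⟨hx, hs⟩ := hz
    obtain ⟨hy, ht⟩ := hw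
    simp only at hx hs hy ht
    have hxK := interior_subset hx
    have hyK := interior_subset hy
    have hT := hs.1.trans hs.2
    have hR0 := hR0 hT
    rw [Real.coe_toNNReal _ (by positivity)]
    have h1 := (isSolution_flow hf y).lipschitzOnWith_sub (isSolution_flow hf x₀) le_rfl hT hL0 hL
      (hR y hyK) (hR x₀ hx₀K) (δ := R + R) fun r hr =>
        (norm_sub_le _ _).trans (add_le_add (hR y hyK r hr) (hR x₀ hx₀K r hr))
    have h2 := h1.dist_le_mul s hs t ht
    rw [Real.coe_toNNReal _ (by positivity), dist_eq_norm] at h2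
    have h3 := hC x hxK y hyK s hs
    have h4 : G (x, s) - G (y, t) = (flow f t₀ s x - flow f t₀ s y) +
        (flow f t₀ s y - flow f t₀ s x₀ - (flow f t₀ t y - flow f t₀ t x₀)) := by
      simp only [hG]; abel
    rw [dist_eq_norm, h4]
    refine (norm_add_le _ _).trans ?_
    rw [add_mul]
    rw [← dist_eq_norm x y] at h3
    refine add_le_add (h3.trans (mul_le_mul_of_nonneg_left ?_ hC0))
      (h2.trans (mul_le_mul_of_nonneg_left ?_ (by positivity)))
    · exact le_max_left _ _
    · exact le_max_right _ _
  have hae := hlip.ae_differentiableWithinAt_of_mem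
    (μ := (volume : Measure (Fin n → ℝ)).prod (volume : Measure ℝ))
  have h1 : ∀ᵐ t : ℝ, t ≠ t₀ := by simp [ae_iff, measure_singleton]
  have h2 : ∀ᵐ t : ℝ, t ≠ T := by simp [ae_iff, measure_singleton]
  filter_upwards [Measure.ae_ae_of_ae_prod hae] with x hx hm
  filter_upwards [hx, h1, h2] with t ht hne₀ hne hmt
  have hnhds : interior K ×ˢ Icc t₀ T ∈ 𝓝 (x, t) :=
    prod_mem_nhds (isOpen_interior.mem_nhds hm)
      (Icc_mem_nhds (lt_of_le_of_ne hmt.1 (Ne.symm hne₀)) (lt_of_le_of_ne hmt.2 hne))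
  have hd : DifferentiableAt ℝ G (x, t) := (ht ⟨hm, hmt⟩).differentiableAt hnhds
  have hcomp : DifferentiableAt ℝ (fun y => G (y, t)) x :=
    DifferentiableAt.comp (g := G) (f := fun y => (y, t)) x hd
      (differentiableAt_id.prodMk (differentiableAt_const t))
  have := hcomp.add_const (flow f t₀ t x₀)
  simpa [hG] using this

/-- The integrated variational equation along an orbit. -/
theorem fderiv_flow_apply_eq (hf_state : ∀ t, t₀ ≤ t → ContDiff ℝ 1 (f t))
    (hf_bdd : JacobianLocallyBounded f t₀) (hf : ForwardComplete f t₀)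
    {K : Set (Fin n → ℝ)} (hK : IsCompact K) {T : ℝ} (hT : t₀ ≤ T) {x : Fin n → ℝ}
    (hx : x ∈ interior K)
    (hd : ∀ᵐ t, t ∈ Icc t₀ T → DifferentiableAt ℝ (flow f t₀ t) x) (e : Fin n → ℝ) :
    IntervalIntegrable (fun r => fderiv ℝ (f r) (flow f t₀ r x) (fderiv ℝ (flow f t₀ r) x e))
      volume t₀ T ∧
    ∀ t ∈ Icc t₀ T, DifferentiableAt ℝ (flow f t₀ t) x →
      fderiv ℝ (flow f t₀ t) x e =
        e + ∫ r in t₀..t, fderiv ℝ (f r) (flow f t₀ r x) (fderiv ℝ (flow f t₀ r) x e) := by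
  obtain ⟨R, L, C, hL0, hC0, hL, hR, hC⟩ := exists_flow_lipschitz hf_state hf_bdd hf hK T
  set w := fun r => fderiv ℝ (f r) (flow f t₀ r x) (fderiv ℝ (flow f t₀ r) x e) with hw
  -- Difference quotients of the field along neighbouring orbits. They converge to `w` for almost
  -- every time and are bounded by `L * (C * ‖e‖)`. As their limit, `w` inherits measurability,
  -- without any regularity in time of the Jacobian.
  set F : ℝ → ℝ → (Fin n → ℝ) := fun h r =>
    h⁻¹ • (f r (flow f t₀ r (x + h • e)) - f r (flow f t₀ r x)) with hF
  have hxK := interior_subset hx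
  have hlim : ∀ᵐ r, r ∈ Icc t₀ T → Tendsto (fun h => F h r) (𝓝[≠] 0) (𝓝 (w r)) := by
    filter_upwards [hd] with r hr hm
    have h1 := ((((hf_state r hm.1).differentiable (by simp)
      (flow f t₀ r x)).hasFDerivAt).comp x (hr hm).hasFDerivAt).hasLineDerivAt e
    exact h1.tendsto_slope_zero
  have hint : ∀ h : ℝ, IntervalIntegrable (F h) volume t₀ T := fun h =>
    (((isSolution_flow hf (x + h • e)).intervalIntegrable le_rfl hT).sub
      ((isSolution_flow hf x).intervalIntegrable le_rfl hT)).smul h⁻¹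
  have hnear : ∀ᶠ h : ℝ in 𝓝[≠] 0, x + h • e ∈ K := by
    have hc : Tendsto (fun h : ℝ => x + h • e) (𝓝 0) (𝓝 (x + (0 : ℝ) • e)) :=
      (continuous_const.add (continuous_id.smul continuous_const)).tendsto 0
    rw [zero_smul, add_zero] at hc
    exact (hc.mono_left nhdsWithin_le_nhds) (mem_interior_iff_mem_nhds.1 hx)
  have hbound : ∀ᶠ h : ℝ in 𝓝[≠] 0, ∀ r ∈ Icc t₀ T, ‖F h r‖ ≤ L * (C * ‖e‖) := by
    filter_upwards [hnear, self_mem_nhdsWithin] with h hh hne r hr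
    have h0 : 0 < |h| := abs_pos.2 hne
    rw [hF]
    simp only
    rw [norm_smul, norm_inv, Real.norm_eq_abs, inv_mul_le_iff₀ h0]
    have h1 := hL r hr _ _ (hR _ hh r hr) (hR x hxK r hr)
    have h2 := hC _ hh x hxK r hr
    rw [add_sub_cancel_left, norm_smul, Real.norm_eq_abs] at h2
    calc _ ≤ _ := h1
      _ ≤ L * (C * (|h| * ‖e‖)) := mul_le_mul_of_nonneg_left h2 hL0
      _ = _ := by ring
  have hmeas : AEStronglyMeasurable w (volume.restrict (Ioc t₀ T)) := by
    refine aestronglyMeasurable_of_tendsto_ae (𝓝[≠] (0 : ℝ)) (f := F)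
      (fun h => (hint h).1.aestronglyMeasurable) ?_
    rw [ae_restrict_iff' measurableSet_Ioc]
    filter_upwards [hlim] with r hr hm using hr (Ioc_subset_Icc_self hm)
  have hwb : ∀ᵐ r, r ∈ Icc t₀ T → ‖w r‖ ≤ L * (C * ‖e‖) := by
    filter_upwards [hlim] with r hr hm
    refine le_of_tendsto (hr hm).norm ?_
    filter_upwards [hbound] with h hh using hh r hm
  have hwint : IntervalIntegrable w volume t₀ T := by
    rw [intervalIntegrable_iff_integrableOn_Ioc_of_le hT]
    refine Integrable.of_bound hmeas (L * (C * ‖e‖)) ?_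
    rw [ae_restrict_iff' measurableSet_Ioc]
    filter_upwards [hwb] with r hr hm using hr (Ioc_subset_Icc_self hm)
  refine ⟨hwint, fun t ht hdt => ?_⟩
  have hsub : ∀ r, r ∈ uIoc t₀ t → r ∈ Icc t₀ T := fun r hr => by
    rw [uIoc_of_le ht.1] at hr
    exact ⟨hr.1.le, hr.2.trans ht.2⟩
  have hdct := intervalIntegral.tendsto_integral_filter_of_dominated_convergence (μ := volume)
    (a := t₀) (b := t) (F := F) (f := w) (l := 𝓝[≠] (0 : ℝ)) (fun _ => L * (C * ‖e‖))
    (Eventually.of_forall fun h => by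
      rw [uIoc_of_le ht.1]
      exact ((hint h).1.mono_set (Ioc_subset_Ioc_right ht.2)).aestronglyMeasurable)
    (by
      filter_upwards [hbound] with h hh
      exact Eventually.of_forall fun r hr => hh r (hsub r hr))
    intervalIntegrable_const
    (by filter_upwards [hlim] with r hr hm using hr (hsub r hm))
  have hlhs : Tendsto (fun h : ℝ => h⁻¹ • (flow f t₀ t (x + h • e) - flow f t₀ t x) - e)
      (𝓝[≠] 0) (𝓝 (fderiv ℝ (flow f t₀ t) x e - e)) :=
    ((hdt.hasFDerivAt.hasLineDerivAt e).tendsto_slope_zero).sub_const e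
  have heq : ∀ᶠ h : ℝ in 𝓝[≠] 0, ∫ r in t₀..t, F h r =
      h⁻¹ • (flow f t₀ t (x + h • e) - flow f t₀ t x) - e := by
    filter_upwards [self_mem_nhdsWithin] with h hne
    have hne' : h ≠ 0 := hne
    simp only [hF]
    have s1 := isSolution_flow hf (x + h • e)
    have s2 := isSolution_flow hf x
    rw [intervalIntegral.integral_smul, intervalIntegral.integral_sub
      (s1.intervalIntegrable le_rfl ht.1) (s2.intervalIntegrable le_rfl ht.1),
      ← s1.sub_eq_integral le_rfl ht.1, ← s2.sub_eq_integral le_rfl ht.1,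
      s1.apply_initial, s2.apply_initial]
    have : flow f t₀ t (x + h • e) - (x + h • e) - (flow f t₀ t x - x) =
        (flow f t₀ t (x + h • e) - flow f t₀ t x) - h • e := by abel
    rw [this, smul_sub, smul_smul, inv_mul_cancel₀ hne', one_smul]
  have := tendsto_nhds_unique (hdct.congr' heq) hlhs
  rw [this]
  abel

/-- A lower bound for the Jacobian determinant of the flow (Liouville's formula). -/
theorem exp_le_abs_det_fderiv_flow (hf_state : ∀ t, t₀ ≤ t → ContDiff ℝ 1 (f t))
    (hf_bdd : JacobianLocallyBounded f t₀) (hf : ForwardComplete f t₀)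
    {K : Set (Fin n → ℝ)} (hK : IsCompact K) {τ T : ℝ} (hτ : t₀ ≤ τ) (hτT : τ ≤ T)
    {x : Fin n → ℝ} (hx : x ∈ interior K)
    (hd : ∀ᵐ t, t ∈ Icc t₀ T → DifferentiableAt ℝ (flow f t₀ t) x)
    (hdT : DifferentiableAt ℝ (flow f t₀ T) x) {k c : ℝ}
    (hk : ∀ t ∈ Icc t₀ τ, k ≤ (jacobian f t (flow f t₀ t x)).trace)
    (hc : ∀ t ∈ Icc τ T, c ≤ (jacobian f t (flow f t₀ t x)).trace) :
    Real.exp (k * (τ - t₀) + c * (T - τ)) ≤ |(fderiv ℝ (flow f t₀ T) x).det| := by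
  have hT := hτ.trans hτT
  set A : ℝ → Matrix (Fin n) (Fin n) ℝ := fun t => jacobian f t (flow f t₀ t x) with hA
  set D : ℝ → Matrix (Fin n) (Fin n) ℝ := fun t =>
    LinearMap.toMatrix' (fderiv ℝ (flow f t₀ t) x : (Fin n → ℝ) →ₗ[ℝ] (Fin n → ℝ)) with hD
  -- `D t` is the true derivative only for almost every `t`, since `fderiv` defaults to `0`
  -- elsewhere. `Z` is its absolutely continuous version, defined by the integrated variational
  -- equation; the two agree wherever the flow is differentiable, in particular at `T`.
  set Z : ℝ → Matrix (Fin n) (Fin n) ℝ := fun t => Matrix.of fun i j =>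
    (1 : Matrix (Fin n) (Fin n) ℝ) i j + ∫ r in t₀..t, (A r * D r) i j with hZ
  have hDapp : ∀ t j, fderiv ℝ (flow f t₀ t) x (Pi.single j 1) = fun i => D t i j := by
    intro t j
    ext i
    simp [hD, LinearMap.toMatrix'_apply]
  have hADapp : ∀ t i j, fderiv ℝ (f t) (flow f t₀ t x)
      (fderiv ℝ (flow f t₀ t) x (Pi.single j 1)) i = (A t * D t) i j := by
    intro t i j
    rw [fderiv_apply_eq_jacobian_mulVec, hDapp]
    rfl
  have hint : ∀ i j, IntervalIntegrable (fun r => (A r * D r) i j) volume t₀ T := by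
    intro i j
    have h1 := (fderiv_flow_apply_eq hf_state hf_bdd hf hK hT hx hd (Pi.single j 1)).1
    have h2 : IntervalIntegrable (fun r => (ContinuousLinearMap.proj (R := ℝ) i : (Fin n → ℝ) →L[ℝ] ℝ)
        (fderiv ℝ (f r) (flow f t₀ r x) (fderiv ℝ (flow f t₀ r) x (Pi.single j 1))))
        volume t₀ T :=
      ⟨ContinuousLinearMap.integrable_comp _ h1.1, ContinuousLinearMap.integrable_comp _ h1.2⟩
    simpa only [ContinuousLinearMap.proj_apply, hADapp] using h2
  have hDZ : ∀ t ∈ Icc t₀ T, DifferentiableAt ℝ (flow f t₀ t) x → D t = Z t := by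
    intro t ht hdt
    refine Matrix.ext fun i j => ?_
    obtain ⟨h0, h1⟩ := fderiv_flow_apply_eq hf_state hf_bdd hf hK hT hx hd (Pi.single j 1)
    have h2 := congrFun (h1 t ht hdt) i
    have h0' := h0.mono_set (uIcc_subset_uIcc_left (by rwa [uIcc_of_le hT]))
    have h3 := (ContinuousLinearMap.proj (R := ℝ) i : (Fin n → ℝ) →L[ℝ] ℝ).intervalIntegral_comp_comm h0'
    simp only [ContinuousLinearMap.proj_apply, hADapp] at h3
    rw [hDapp, Pi.add_apply, ← h3] at h2
    refine h2.trans ?_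
    simp only [hZ, Matrix.of_apply, Matrix.one_apply, Pi.single_apply]
  have hac : ∀ i j, AbsolutelyContinuousOnInterval (fun t => Z t i j) t₀ T := fun i j =>
    (AbsolutelyContinuousOnInterval.const _ t₀ T).fun_add
      ((hint i j).absolutelyContinuousOnInterval_intervalIntegral left_mem_uIcc)
  have hderiv : ∀ᵐ t, t ∈ Icc t₀ T → ∀ i j,
      HasDerivAt (fun s => Z s i j) ((A t * Z t) i j) t := by
    have h1 : ∀ᵐ t, ∀ i j, t ∈ uIcc t₀ T → ∀ a ∈ uIcc t₀ T,
        HasDerivAt (fun s => ∫ r in a..s, (A r * D r) i j) ((A t * D t) i j) t :=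
      ae_all_iff.2 fun i => ae_all_iff.2 fun j => (hint i j).ae_hasDerivAt_integral
    filter_upwards [h1, hd] with t ht hdt hm i j
    rw [← hDZ t hm (hdt hm)]
    exact (ht i j (by rwa [uIcc_of_le hT]) t₀ left_mem_uIcc).const_add _
  have hZ0 : Z t₀ = 1 := by
    ext i j
    simp [hZ]
  have g1 := exp_mul_det_sq_le (A := A) hτ
    (fun i j => (hac i j).mono (by
      rw [uIcc_of_le hT, uIcc_of_le hτ]; exact Icc_subset_Icc_right hτT))
    (by filter_upwards [hderiv] with t ht hm using ht ⟨hm.1, hm.2.trans hτT⟩) hk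
  have g2 := exp_mul_det_sq_le (A := A) hτT
    (fun i j => (hac i j).mono (by
      rw [uIcc_of_le hT, uIcc_of_le hτT]; exact Icc_subset_Icc_left hτ))
    (by filter_upwards [hderiv] with t ht hm using ht ⟨hτ.trans hm.1, hm.2⟩) hc
  rw [hZ0, Matrix.det_one, one_pow, mul_one] at g1
  have hdet : (fderiv ℝ (flow f t₀ T) x).det = (Z T).det := by
    rw [← hDZ T ⟨hT, le_rfl⟩ hdT, hD, LinearMap.det_toMatrix']
  rw [hdet]
  refine (pow_le_pow_iff_left₀ (Real.exp_pos _).le (abs_nonneg _) two_ne_zero).1 ?_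
  rw [sq_abs, ← Real.exp_nat_mul]
  refine le_trans ?_ (le_trans (mul_le_mul_of_nonneg_left g1 (Real.exp_pos _).le) g2)
  rw [← Real.exp_add]
  refine (congrArg Real.exp ?_).le
  push_cast
  ring

/-- The points of `interior K` where the determinant bound applies form a set of full measure, and
the flow is injective on it, so integrating the bound gives the volume of its image. -/
theorem ofReal_exp_mul_volume_le (hf_state : ∀ t, t₀ ≤ t → ContDiff ℝ 1 (f t))
    (hf_bdd : JacobianLocallyBounded f t₀) (hf : ForwardComplete f t₀)
    {K : Set (Fin n → ℝ)} (hK : IsCompact K) {τ T : ℝ} (hτ : t₀ ≤ τ) (hτT : τ ≤ T) {k c : ℝ}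
    (hk : ∀ x ∈ K, ∀ t ∈ Icc t₀ τ, k ≤ (jacobian f t (flow f t₀ t x)).trace)
    (hc : ∀ x ∈ K, ∀ t ∈ Icc τ T, c ≤ (jacobian f t (flow f t₀ t x)).trace) :
    ENNReal.ofReal (Real.exp (k * (τ - t₀) + c * (T - τ))) * volume (interior K) ≤
      volume (reachableSet f t₀ T K) := by
  have hT := hτ.trans hτT
  set g : ENNReal := ENNReal.ofReal (Real.exp (k * (τ - t₀) + c * (T - τ)))
  have h1 := ae_differentiableAt_flow hf_state hf_bdd hf hK hT
  have h2 := ae_ae_differentiableAt_flow hf_state hf_bdd hf hK T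
  set S : Set (Fin n → ℝ) := {x | x ∈ interior K ∧ DifferentiableAt ℝ (flow f t₀ T) x ∧
    ∀ᵐ t, t ∈ Icc t₀ T → DifferentiableAt ℝ (flow f t₀ t) x} with hS
  have hSae : S =ᵐ[volume] interior K := by
    rw [Filter.eventuallyEq_set]
    filter_upwards [h1, h2] with x hx1 hx2
    exact ⟨fun h => h.1, fun h => ⟨h, hx1 h, hx2 h⟩⟩
  have hSnull : NullMeasurableSet S volume :=
    isOpen_interior.measurableSet.nullMeasurableSet.congr hSae.symm
  have hSK : S ⊆ K := fun x hx => interior_subset hx.1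
  have hcv := lintegral_abs_det_fderiv_eq_addHaar_image₀ volume hSnull
    (fun x hx => hx.2.1.hasFDerivAt.hasFDerivWithinAt)
    ((injOn_flow hf_state hf_bdd hf hK hT).mono hSK)
  calc g * volume (interior K) = ∫⁻ _ in S, g := by
        rw [setLIntegral_const, measure_congr hSae]
    _ ≤ ∫⁻ x in S, ENNReal.ofReal |(fderiv ℝ (flow f t₀ T) x).det| := by
        refine lintegral_mono_ae ?_
        rw [ae_restrict_iff'₀ hSnull]
        refine Eventually.of_forall fun x hx => ENNReal.ofReal_le_ofReal ?_
        exact exp_le_abs_det_fderiv_flow hf_state hf_bdd hf hK hτ hτT hx.1 hx.2.2 hx.2.1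
          (hk x (hSK hx)) (hc x (hSK hx))
    _ = volume (flow f t₀ T '' S) := hcv
    _ ≤ _ := measure_mono (image_mono hSK)

theorem exists_le_trace_of_lt_chiCheck {K : Set (Fin n → ℝ)} {c : ℝ} (h : c < chiCheck f t₀ K) :
    ∃ τ, t₀ ≤ τ ∧ ∀ t, τ ≤ t → ∀ x ∈ K, c ≤ (jacobian f t (flow f t₀ t x)).trace := by
  obtain ⟨τ, hτ⟩ := eventually_atTop.1 (eventually_lt_of_lt_liminf h)
  refine ⟨max τ t₀, le_max_right _ _, fun t ht x hx => ?_⟩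
  have h1 := (hτ t ((le_max_left _ _).trans ht)).le.trans
    (iInf₂_le (f := fun (v : Fin n → ℝ) (_ : v ∈ reachableSet f t₀ t K) =>
      ((jacobian f t v).trace : EReal)) (flow f t₀ t x) (mem_image_of_mem _ hx))
  exact_mod_cast h1

/-- Spanning is only needed at the final time: there the balls centred at the endpoints of the
orbits from `E` cover the reachable set, and all are translates of one set. -/
theorem volume_reachableSet_le {N : Seminorm ℝ (Fin n → ℝ)} {K : Set (Fin n → ℝ)} {T ε : ℝ}
    (hT : 0 ≤ T) {E : Set (Fin n → ℝ)} (hE : IsSpanning N f t₀ K T ε E) (hfin : E.Finite) :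
    volume (reachableSet f t₀ (t₀ + T) K) ≤ E.ncard * volume {v | N v < ε} := by
  have hsub : reachableSet f t₀ (t₀ + T) K ⊆
      ⋃ x ∈ hfin.toFinset, (fun v => v - flow f t₀ (t₀ + T) x) ⁻¹' {v | N v < ε} := by
    rintro _ ⟨y, hy, rfl⟩
    obtain ⟨x, hx, hxy⟩ := hE.2 y hy
    exact mem_iUnion₂.2 ⟨x, by simpa using hx, hxy _ ⟨by linarith, le_rfl⟩⟩
  refine (measure_mono hsub).trans ((measure_biUnion_finset_le _ _).trans ?_)
  simp only [sub_eq_add_neg, measure_preimage_add_right, Finset.sum_const, nsmul_eq_mul]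
  rw [Set.ncard_eq_toFinset_card E hfin]

theorem exists_exp_le_spanningNumber {N : Seminorm ℝ (Fin n → ℝ)} (hN : ∀ x, N x = 0 → x = 0)
    (hf_state : ∀ t, t₀ ≤ t → ContDiff ℝ 1 (f t)) (hf_bdd : JacobianLocallyBounded f t₀)
    (hf : ForwardComplete f t₀) {K : Set (Fin n → ℝ)} (hK : IsCompact K)
    (hK_int : (interior K).Nonempty) {c : ℝ} (h : c < chiCheck f t₀ K) (ε : ℝ) :
    ∃ C T₁ : ℝ, 0 < C ∧ ∀ T, T₁ ≤ T → ENNReal.ofReal (C * Real.exp (c * T)) ≤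
      (spanningNumber N f t₀ K T ε : ENNReal) := by
  obtain ⟨τ, hτ0, hτ⟩ := exists_le_trace_of_lt_chiCheck h
  obtain ⟨R, hR⟩ := exists_flow_bound hf_state hf_bdd hf hK τ
  obtain ⟨C, hC⟩ := hf_bdd τ R
  -- Before `τ` only the local bound on the Jacobian entries is available. The loss is a factor
  -- independent of `T`.
  have hk : ∀ x ∈ K, ∀ t ∈ Icc t₀ τ, -(n * C) ≤ (jacobian f t (flow f t₀ t x)).trace := by
    intro x hx t ht
    have h1 : ∑ _i : Fin n, -C ≤ (jacobian f t (flow f t₀ t x)).trace :=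
      Finset.sum_le_sum fun i _ => (abs_le.1 (hC t ht _ (hR x hx t ht) i i)).1
    simpa using h1
  obtain ⟨a, ha0, ha⟩ := N.exists_norm_le hN
  set V := (volume {v : Fin n → ℝ | N v < ε}) with hV
  have hVtop : V ≠ ⊤ := by
    have hb : Bornology.IsBounded {v : Fin n → ℝ | N v < ε} := by
      refine (Metric.isBounded_closedBall (x := (0 : Fin n → ℝ)) (r := ε / a)).subset fun v hv => ?_
      rw [mem_closedBall_zero_iff, le_div_iff₀ ha0, mul_comm]
      exact (ha v).trans (le_of_lt hv)
    exact hb.measure_lt_top.ne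
  set U := volume (interior K) with hU
  have hUtop : U ≠ ⊤ := ((measure_mono interior_subset).trans_lt hK.measure_lt_top).ne
  have hU0 : 0 < U.toReal :=
    ENNReal.toReal_pos (isOpen_interior.measure_pos volume hK_int).ne' hUtop
  -- The exponential corrects the rate on `[t₀, τ]`. The `+ 1` avoids dividing by zero, since `V =
  -- 0` for `ε ≤ 0`.
  refine ⟨Real.exp ((-(n * C) - c) * (τ - t₀)) * U.toReal / (V.toReal + 1), max (τ - t₀) 0,
    by positivity, fun T hT => ?_⟩
  have hT0 : 0 ≤ T := (le_max_right _ _).trans hT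
  have hT1 : τ ≤ t₀ + T := by linarith [(le_max_left (τ - t₀) 0).trans hT]
  by_cases htop : spanningNumber N f t₀ K T ε = ⊤
  · simp [htop]
  obtain ⟨E, hE, hEle⟩ : ∃ E, IsSpanning N f t₀ K T ε E ∧
      E.encard ≤ spanningNumber N f t₀ K T ε := by
    -- A finite infimum of values in `ℕ∞` is attained: some value lies below the infimum plus one.
    have hlt : spanningNumber N f t₀ K T ε < spanningNumber N f t₀ K T ε + 1 :=
      ENat.lt_add_one_iff htop |>.2 le_rfl
    conv_lhs at hlt => rw [spanningNumber]
    obtain ⟨E, hE, hlt⟩ := by simpa only [iInf_lt_iff, exists_prop] using hlt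
    exact ⟨E, hE, (ENat.lt_add_one_iff htop).1 hlt⟩
  have hfin : E.Finite := encard_ne_top_iff.1 (ne_top_of_le_ne_top htop hEle)
  have hvol := (ofReal_exp_mul_volume_le hf_state hf_bdd hf hK hτ0 hT1 hk
    (fun x hx t ht => hτ t ht.1 x hx)).trans (volume_reachableSet_le hT0 hE hfin)
  have hreal := ENNReal.toReal_mono (ENNReal.mul_ne_top (by simp) hVtop) hvol
  rw [ENNReal.toReal_mul, ENNReal.toReal_mul, ENNReal.toReal_ofReal (Real.exp_pos _).le,
    ENNReal.toReal_natCast] at hreal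
  refine le_trans ?_ (ENat.toENNReal_le.2 hEle)
  rw [← hfin.cast_ncard_eq, ENat.toENNReal_coe, ← ENNReal.ofReal_natCast]
  refine ENNReal.ofReal_le_ofReal ?_
  have hV0 : 0 ≤ V.toReal := ENNReal.toReal_nonneg
  rw [div_mul_eq_mul_div, div_le_iff₀ (by positivity)]
  have he : Real.exp (-(n * C) * (τ - t₀) + c * (t₀ + T - τ)) =
      Real.exp ((-(n * C) - c) * (τ - t₀)) * Real.exp (c * T) := by
    rw [← Real.exp_add]; ring_nf
  rw [he] at hreal
  have hn0 : (0 : ℝ) ≤ E.ncard := Nat.cast_nonneg _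
  linarith

end LowerBound

/-! ### From counting estimates to the entropy. -/

section Entropy

variable {n : ℕ} {f : ℝ → (Fin n → ℝ) → (Fin n → ℝ)} {t₀ : ℝ}

theorem spanningNumber_antitone (N : Seminorm ℝ (Fin n → ℝ)) (K : Set (Fin n → ℝ)) (T : ℝ) :
    Antitone (spanningNumber N f t₀ K T) := fun _ _ h =>
  le_iInf₂ fun E hE => iInf₂_le E ⟨hE.1, fun y hy =>
    let ⟨x, hx, hxy⟩ := hE.2 y hy
    ⟨x, hx, fun t ht => (hxy t ht).trans_le h⟩⟩

theorem one_le_spanningNumber (N : Seminorm ℝ (Fin n → ℝ)) {K : Set (Fin n → ℝ)}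
    (hK : K.Nonempty) (T ε : ℝ) : 1 ≤ spanningNumber N f t₀ K T ε := by
  obtain ⟨y, hy⟩ := hK
  refine le_iInf₂ fun E hE => one_le_encard_iff_nonempty.2 ?_
  obtain ⟨x, hx, -⟩ := hE.2 y hy
  exact ⟨x, hx⟩

/-- The limit that defines the topological entropy exists. -/
theorem tendsto_topEntropy (N : Seminorm ℝ (Fin n → ℝ)) (K : Set (Fin n → ℝ)) :
    Tendsto (fun ε : ℝ => limsup (fun T : ℝ =>
      ((1 / T : ℝ) : EReal) * ENNReal.log (spanningNumber N f t₀ K T ε : ENNReal)) atTop)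
      (𝓝[>] 0) (𝓝 (topEntropy N f t₀ K)) := by
  refine tendsto_nhds_limUnder ⟨_, Antitone.tendsto_nhdsGT (fun ε ε' h => ?_) 0⟩
  refine limsup_le_limsup ?_
  filter_upwards [eventually_gt_atTop 0] with T hT
  refine mul_le_mul_of_nonneg_left (ENNReal.log_monotone ?_) (by positivity)
  exact ENat.toENNReal_le.2 (spanningNumber_antitone N K T h)

/-- Both counting bounds have the form `C * exp (c * T)`; division by `T` removes `C` and leaves the
rate. -/
theorem tendsto_one_div_mul_log_exp {C : ℝ} (hC : 0 < C) (c : ℝ) :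
    Tendsto (fun T : ℝ => ((1 / T : ℝ) : EReal) *
      ENNReal.log (ENNReal.ofReal (C * Real.exp (c * T)))) atTop (𝓝 (c : EReal)) := by
  have h1 : Tendsto (fun T : ℝ => Real.log C * T⁻¹ + c) atTop (𝓝 c) := by
    simpa using (tendsto_inv_atTop_zero.const_mul (Real.log C)).add_const c
  refine ((continuous_coe_real_ereal.tendsto c).comp h1).congr' ?_
  filter_upwards [eventually_gt_atTop 0] with T hT
  rw [ENNReal.log_ofReal_of_pos (by positivity), ← EReal.coe_mul,
    Real.log_mul hC.ne' (Real.exp_pos _).ne', Real.log_exp]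
  simp only [Function.comp_apply]
  congr 1
  field_simp

theorem topEntropy_le_of_muHat_lt (N : Seminorm ℝ (Fin n → ℝ))
    {M : Seminorm ℝ (Fin n → ℝ)} (hM : ∀ x, M x = 0 → x = 0)
    (hf_state : ∀ t, t₀ ≤ t → ContDiff ℝ 1 (f t)) (hf_bdd : JacobianLocallyBounded f t₀)
    (hf : ForwardComplete f t₀) {K : Set (Fin n → ℝ)} (hK : IsCompact K) {c : ℝ} (hc : 0 ≤ c)
    (h : muHat M f t₀ K < c) : topEntropy N f t₀ K ≤ ((n * c : ℝ) : EReal) := by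
  refine le_of_tendsto (tendsto_topEntropy N K) ?_
  filter_upwards [self_mem_nhdsWithin] with ε hε
  obtain ⟨C, hC0, hC⟩ := exists_spanningNumber_le_exp N hM hf_state hf_bdd hf hK hc h hε
  refine (limsup_le_limsup ?_).trans (tendsto_one_div_mul_log_exp hC0 (n * c)).limsup_eq.le
  filter_upwards [eventually_gt_atTop 0] with T hT
  obtain ⟨k, hk, hk'⟩ := hC T hT.le
  refine mul_le_mul_of_nonneg_left (ENNReal.log_monotone ?_) (by positivity)
  refine (ENat.toENNReal_le.2 hk).trans ?_
  rw [ENat.toENNReal_coe, ← ENNReal.ofReal_natCast]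
  exact ENNReal.ofReal_le_ofReal hk'

theorem le_topEntropy_of_lt_chiCheck {N : Seminorm ℝ (Fin n → ℝ)} (hN : ∀ x, N x = 0 → x = 0)
    (hf_state : ∀ t, t₀ ≤ t → ContDiff ℝ 1 (f t)) (hf_bdd : JacobianLocallyBounded f t₀)
    (hf : ForwardComplete f t₀) {K : Set (Fin n → ℝ)} (hK : IsCompact K)
    (hK_int : (interior K).Nonempty) {c : ℝ} (h : c < chiCheck f t₀ K) :
    (c : EReal) ≤ topEntropy N f t₀ K := by
  refine ge_of_tendsto (tendsto_topEntropy N K) (Eventually.of_forall fun ε => ?_)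
  obtain ⟨C, T₁, hC0, hC⟩ :=
    exists_exp_le_spanningNumber hN hf_state hf_bdd hf hK hK_int h ε
  refine (tendsto_one_div_mul_log_exp hC0 c).limsup_eq.ge.trans (limsup_le_limsup ?_)
  filter_upwards [eventually_gt_atTop 0, eventually_ge_atTop T₁] with T hT hT₁
  exact mul_le_mul_of_nonneg_left (ENNReal.log_monotone (hC T hT₁)) (by positivity)

theorem topEntropy_nonneg (N : Seminorm ℝ (Fin n → ℝ)) {K : Set (Fin n → ℝ)}
    (hK : K.Nonempty) : 0 ≤ topEntropy N f t₀ K := by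
  refine ge_of_tendsto (tendsto_topEntropy N K) (Eventually.of_forall fun ε => ?_)
  refine le_limsup_of_frequently_le (Eventually.frequently ?_)
  filter_upwards [eventually_gt_atTop 0] with T hT
  refine mul_nonneg (by positivity) ?_
  rw [← ENNReal.log_one]
  refine ENNReal.log_monotone ?_
  exact_mod_cast ENat.toENNReal_le.2 (one_le_spanningNumber N hK T ε)

end Entropy

/-! ### The entropy bounds in the extended reals. -/

theorem theorem1 {n : ℕ} (hn : 0 < n) (f : ℝ → (Fin n → ℝ) → (Fin n → ℝ)) (t₀ : ℝ)
    (hf_time : PiecewiseContinuousInTime f t₀)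
    (hf_state : ∀ t, t₀ ≤ t → ContDiff ℝ 1 (f t))
    (hf_bdd : JacobianLocallyBounded f t₀)
    (hf_complete : ForwardComplete f t₀)
    (K : Set (Fin n → ℝ)) (hK : IsCompact K) (hK_int : (interior K).Nonempty)
    -- `N` is the norm in the definition of entropy; `M` induces the matrix norm behind `μ`
    (N : Seminorm ℝ (Fin n → ℝ)) (hN : ∀ x, N x = 0 → x = 0)
    (M : Seminorm ℝ (Fin n → ℝ)) (hM : ∀ x, M x = 0 → x = 0) :
    topEntropy N f t₀ K ≤ (n : EReal) * max (muHat M f t₀ K) 0 ∧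
      max (chiCheck f t₀ K) 0 ≤ topEntropy N f t₀ K := by
  have hn' : (0 : ℝ) < n := Nat.cast_pos.2 hn
  refine ⟨?_, max_le (EReal.ge_of_forall_gt_iff_ge.1 fun c hc =>
    le_topEntropy_of_lt_chiCheck hN hf_state hf_bdd hf_complete hK hK_int hc)
    (topEntropy_nonneg N (hK_int.mono interior_subset))⟩
  have hcast : (n : EReal) = ((n : ℝ) : EReal) := rfl
  rw [hcast]
  set m := max (muHat M f t₀ K) 0 with hm
  have hm0 : 0 ≤ m := le_max_right _ _
  -- If `m = ⊤`, positivity of `n` gives `n * ⊤ = ⊤`. Otherwise the bound is tested against every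
  -- real `z > n * m`, using the rate `z / n`, which exceeds `m` and hence both `0` and `muHat`.
  rcases eq_or_ne m ⊤ with htop | htop
  · rw [htop, EReal.coe_mul_top_of_pos hn']
    exact le_top
  · lift m to ℝ using ⟨htop, ne_bot_of_le_ne_bot (by simp) hm0⟩ with r hr
    rw [← EReal.coe_mul]
    refine EReal.le_of_forall_lt_iff_le.1 fun z hz => ?_
    rw [EReal.coe_lt_coe_iff, mul_comm, ← lt_div_iff₀ hn'] at hz
    have hlt : muHat M f t₀ K < ((z / n : ℝ) : EReal) :=
      ((le_max_left _ _).trans hm.ge).trans_lt (EReal.coe_lt_coe_iff.2 hz)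
    have h := topEntropy_le_of_muHat_lt N hM hf_state hf_bdd hf_complete hK
      ((EReal.coe_nonneg.1 hm0).trans hz.le) hlt
    rwa [mul_div_cancel₀ _ hn'.ne'] at h
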